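/- For $1\le p\le\infty$ let $\ell_p^n(\mathbb C)$ be $\mathbb C^n$ with the norm $\|\cdot\|_p$ (the maximum norm for $p=\infty$), and let $\langle x,y\rangle=\sum_{j=1}^n x_j\overline{y_j}$. A vector $x\in\mathbb C^n$ is unimodular if $|x_j|=1$ for all $j$. For a complex matrix $A$ let $\|A\|_{p\to q}$ be the operator norm of $A:\ell_p^n(\mathbb C)\to\ell_q^n(\mathbb C)$. For finite-dimensional normed spaces $X,Y$ of the same dimension over the same field let $d_{BM}(X,Y)=\inf\|A\|_{X\to Y}\,\|A^{-1}\|_{Y\to X}$, where the infimum is over all linear isomorphisms $A:X\to Y$. Then: (i) Let $n\in\{2,3\}$. If $a_1,\dots,a_n\in\mathbb C^n$ satisfy $\|a_i\|_\infty\le 1$ for every $i$, then there is a unimodular vector $x\in\mathbb C^n$ such that $|\langle x,a_i\rangle|\le\sqrt n$ for every $i=1,\dots,n$. The bound is sharp: there are $a_1,\dots,a_n\in\mathbb C^n$ with $\|a_i\|_\infty\le1$ for every $i$ such that every unimodular $x\in\mathbb C^n$ satisfies $|\langle x,a_i\rangle|\ge\sqrt n$ for at least one $i$. (ii) $d_{BM}(\ell_1^n(\mathbb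 C),\ell_\infty^n(\mathbb C))=\sqrt n$ for $n=2$ and $n=3$. (iii) For all $1\le q\le 2\le p\le\infty$, $$d_{BM}(\ell_p^2(\mathbb C),\ell_q^2(\mathbb C))=2^{\alpha},\qquad \alpha=\max\left\{\tfrac12-\tfrac1p,\ \tfrac1q-\tfrac12\right\},$$ where $\tfrac1\infty=0$. (iv) Every complex $2\times2$ matrix $A$ satisfies $\|A\|_{\infty\to1}\ge 2\sqrt{|\det A|}$. -/

import Mathlib

open scoped ENNReal

/-- The complex space `ℓ_p^n(ℂ)`: the space `ℂ^n` with the norm `‖·‖_p` (the maximum norm if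
`p = ∞`). -/
abbrev ComplexEll (p : ℝ≥0∞) (n : ℕ) : Type := PiLp p (fun _ : Fin n => ℂ)

/-- The Banach–Mazur distance: the infimum of `‖A‖ * ‖A⁻¹‖` over all invertible operators
`A : X → Y`. For finite-dimensional spaces every linear isomorphism is continuous, so that `A` then
ranges over all linear isomorphisms. -/
noncomputable def banachMazurDist (𝕜 X Y : Type*) [NontriviallyNormedField 𝕜]
    [NormedAddCommGroup X] [NormedSpace 𝕜 X] [NormedAddCommGroup Y] [NormedSpace 𝕜 Y] : ℝ :=
  ⨅ A : X ≃L[𝕜] Y, ‖(A : X →L[𝕜] Y)‖ * ‖(A.symm : Y →L[𝕜] X)‖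

/-- The standard inner product `⟨x, y⟩ = ∑ x_j * conj y_j` on `ℂ^n`, linear in the first
argument. -/
noncomputable def stdInner {n : ℕ} (x y : Fin n → ℂ) : ℂ :=
  ∑ j, x j * (starRingEnd ℂ) (y j)

/-- A vector all of whose coordinates have modulus one. -/
def IsUnimodular {n : ℕ} (x : Fin n → ℂ) : Prop := ∀ j, ‖x j‖ = 1

/-- The operator norm `‖A‖_{p → q}` of the operator `x ↦ A x` from `ℓ_p^n(ℂ)` to `ℓ_q^n(ℂ)`. -/
noncomputable def matrixOpNorm {n : ℕ} (p q : ℝ≥0∞) [Fact (1 ≤ p)] [Fact (1 ≤ q)]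
    (A : Matrix (Fin n) (Fin n) ℂ) : ℝ :=
  ‖LinearMap.toContinuousLinearMap
    (Matrix.toLpLin p q A : ComplexEll p n →ₗ[ℂ] ComplexEll q n)‖

/-!
**Balancing three vectors.** Fix unimodular `x` and consider the nine vectors
`(x₀, ω^i x₁, ω^j x₂)`, where `ω` is a cube root of unity. A vector `a` of the unit ball of `ℓ_∞^3`
is violated at `(i, j)` if `|c₀ + ω^i c₁ + ω^j c₂| > √3`, where `c_k = x_k conj(a_k)` lies in the
unit disc. The set of violations in `(ℤ/3)²` is restricted by Parseval's identity
(`normSq_add_normSq_add_normSq`) and by two facts of plane geometry (`not_both_rotations` and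
`normSq_rotation_le_three`); these restrictions are `IsAdmissible`. A finite check shows that two
admissible sets and one further point never cover `(ℤ/3)²` (`IsAdmissible.exists_not_mem`). Hence it
suffices to choose `x` so that the first of the three vectors is violated at most at `(0, 0)`
(`exists_normSq_le_three_of_ne_zero`). If `|a₀|, |a₁|, |a₂|` satisfy the triangle inequalities, the
phases of `x` can be chosen with `c₀ + c₁ + c₂ = 0`; then the nine sums are small except for two of
them, of which at most one exceeds `√3`. Otherwise opposite phases make all nine sums small. For two
vectors in dimension two it is enough to place two numbers in a common half plane.

**The distance of `ℓ_1^n` and `ℓ_∞^n`.** The lower bound applies the balancing result to the rows of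
the matrix of an isomorphism. The upper bound, and the sharpness of the balancing result, come from
the character table of `ℤ/n`, which is `√n` times an isometry of the Euclidean norm.

**Operators from `ℓ_∞^2` to `ℓ_1^2`.** For `|z| = 1` the product `(a + b z)(c + d z) / z` runs
through an ellipse, and an end of its major axis has modulus at least `|a d - b c|`
(`exists_norm_det_le_mul`). The inequality between the arithmetic and the geometric mean gives the
bound by the determinant.

**The distance of `ℓ_p^2` and `ℓ_q^2`.** The upper bound comes from the Hadamard matrix, whose norms
are computed by the Hausdorff–Young inequality for `ℤ/2`, a consequence of the three lines theorem
(`norm_hadamard_bilin_le`). For the lower bound, the determinants of an isomorphism and of its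
inverse have product `1`, and both are bounded by the operator norms: the first by the previous
paragraph, the second by Hadamard's inequality for the rows or for the columns.
-/

/-! ### Cube roots of unity and rotations of three points of the disc -/

/-- The primitive cube root of unity `exp (2πi/3)`. -/
noncomputable def cubeRoot : ℂ := ⟨-1 / 2, √3 / 2⟩

/-- The three powers `1, ω, ω²` of the cube root of unity, indexed by `Fin 3 = ℤ/3`. -/
noncomputable def cubeRootPow : Fin 3 → ℂ := ![1, cubeRoot, cubeRoot ^ 2]

lemma sqrt_three_mul_self : √3 * √3 = (3 : ℝ) := Real.mul_self_sqrt (by norm_num)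

lemma cubeRoot_sq : cubeRoot ^ 2 = ⟨-1 / 2, -(√3 / 2)⟩ := by
  have h := sqrt_three_mul_self
  rw [pow_two]
  apply Complex.ext <;> simp [cubeRoot] <;> linarith

lemma cubeRoot_cube : cubeRoot ^ 3 = 1 := by
  have h := sqrt_three_mul_self
  rw [pow_succ, cubeRoot_sq]
  apply Complex.ext <;> simp [cubeRoot] <;> linarith

lemma one_add_cubeRoot_add_sq : 1 + cubeRoot + cubeRoot ^ 2 = 0 := by
  rw [cubeRoot_sq]
  apply Complex.ext
  · simp [cubeRoot]
    linarith
  · simp [cubeRoot]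

lemma norm_cubeRoot : ‖cubeRoot‖ = 1 := by
  have h : ‖cubeRoot‖ ^ 3 = 1 := by rw [← norm_pow, cubeRoot_cube, norm_one]
  exact (pow_eq_one_iff_of_nonneg (norm_nonneg _) (by norm_num)).1 h

lemma normSq_cubeRoot : Complex.normSq cubeRoot = 1 := by
  rw [Complex.normSq_eq_norm_sq, norm_cubeRoot, one_pow]

lemma normSq_cubeRoot_mul (x : ℂ) : Complex.normSq (cubeRoot * x) = Complex.normSq x := by
  rw [map_mul, normSq_cubeRoot, one_mul]

lemma norm_cubeRootPow (i : Fin 3) : ‖cubeRootPow i‖ = 1 := by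
  fin_cases i <;> simp [cubeRootPow, norm_cubeRoot]

lemma cubeRootPow_zero : cubeRootPow 0 = 1 := rfl

lemma cubeRootPow_add_one (i : Fin 3) : cubeRootPow (i + 1) = cubeRoot * cubeRootPow i := by
  have h := cubeRoot_cube
  fin_cases i
  · simp [cubeRootPow]
  · simp [cubeRootPow, pow_two]
  · simp [cubeRootPow]; rw [← h]; ring

lemma cubeRootPow_add_two (i : Fin 3) :
    cubeRootPow (i + 2) = cubeRoot ^ 2 * cubeRootPow i := by
  rw [show i + 2 = (i + 1) + 1 by rw [add_assoc]; rfl, cubeRootPow_add_one, cubeRootPow_add_one]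
  ring

lemma exists_norm_eq_one_mul_eq_norm (s : ℂ) : ∃ τ : ℂ, ‖τ‖ = 1 ∧ τ * s = ‖s‖ := by
  rcases eq_or_ne s 0 with rfl | hs
  · exact ⟨1, by simp, by simp⟩
  · have h : (‖s‖ : ℂ) ≠ 0 := by exact_mod_cast norm_ne_zero_iff.2 hs
    refine ⟨(starRingEnd ℂ) s / ‖s‖, ?_, ?_⟩
    · rw [norm_div, Complex.norm_conj, Complex.norm_real, norm_norm,
        div_self (norm_ne_zero_iff.2 hs)]
    · rw [div_mul_eq_mul_div, mul_comm, Complex.mul_conj, Complex.normSq_eq_norm_sq]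
      push_cast
      field_simp

/-- Parseval's identity on `ℤ/3`: twisting `x + y + z` by the three characters,
the mean of the squared moduli is `|x|² + |y|² + |z|²`. -/
lemma normSq_add_normSq_add_normSq (x y z : ℂ) :
    Complex.normSq (x + y + z) + Complex.normSq (x + cubeRoot * y + cubeRoot ^ 2 * z)
      + Complex.normSq (x + cubeRoot ^ 2 * y + cubeRoot * z)
      = 3 * (Complex.normSq x + Complex.normSq y + Complex.normSq z) := by
  have h := sqrt_three_mul_self
  have h2 : √3 ^ 2 = (3 : ℝ) := by rw [pow_two, h]
  rw [cubeRoot_sq]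
  simp only [cubeRoot, Complex.normSq_apply, Complex.add_re, Complex.add_im, Complex.mul_re,
    Complex.mul_im]
  ring_nf
  rw [h2]
  ring

/-- If `s > 0` is the sum of three numbers of the unit disc, and `u + iv` is one of them that may
be rotated by either cube root of unity so that the sum gets a modulus greater than `√3`, then `u`
lies far to the left. -/
lemma two_mul_lt_of_both_rotations {s u v : ℝ} (hs : 0 < s) (hs3 : s ≤ 3) (huv : u * u + v * v ≤ 1)
    (h₁ : 3 < s * s + 3 * (u * u + v * v) - 3 * s * u - √3 * s * v)
    (h₂ : 3 < s * s + 3 * (u * u + v * v) - 3 * s * u + √3 * s * v) : 2 * u < s - 1 := by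
  have h3 := sqrt_three_mul_self
  have hk : 0 ≤ √3 := Real.sqrt_nonneg _
  by_contra! hu
  -- reduce to `v ≥ 0` and put `t = √3 |v|`
  obtain ⟨t, ht0, ht, hb⟩ : ∃ t : ℝ, 0 ≤ t ∧ t * t = 3 * (v * v) ∧
      3 < s * s + 3 * (u * u + v * v) - 3 * s * u - s * t := by
    rcases le_total 0 v with hv | hv
    · exact ⟨√3 * v, by positivity, by nlinarith, by linarith⟩
    · exact ⟨√3 * (-v), mul_nonneg hk (by linarith), by nlinarith, by linarith⟩
  rcases le_or_gt (s - 3 * u) t with hc | hc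
  · nlinarith
  · have key : 0 ≤ 3 - 3 * (u * u) - s * s + 3 * s * u + 3 * u * t := by
      rcases le_total 0 u with h0 | h0
      · have : 0 ≤ u * t := mul_nonneg h0 ht0
        nlinarith
      · nlinarith
    nlinarith [mul_nonneg ht0 (sub_nonneg.2 hc.le)]

/-- No two of three numbers `x`, `y`, `z` of the unit disc can both be rotated by either cube root
of unity so that the sum gets a modulus greater than `√3`: otherwise the third would have modulus
greater than `1`. -/
lemma not_both_rotations {x y z : ℂ} (hx : Complex.normSq x ≤ 1) (hy : Complex.normSq y ≤ 1)
    (hz : Complex.normSq z ≤ 1) (h₁ : 3 < Complex.normSq (cubeRoot * x + y + z))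
    (h₂ : 3 < Complex.normSq (cubeRoot ^ 2 * x + y + z))
    (h₃ : 3 < Complex.normSq (x + cubeRoot * y + z))
    (h₄ : 3 < Complex.normSq (x + cubeRoot ^ 2 * y + z)) : False := by
  have h3 := sqrt_three_mul_self
  wlog hr : (x + y + z).im = 0 ∧ 0 ≤ (x + y + z).re generalizing x y z
  · obtain ⟨τ, hτ, hs⟩ := exists_norm_eq_one_mul_eq_norm (x + y + z)
    have hN : ∀ w, Complex.normSq (τ * w) = Complex.normSq w := fun w => by
      rw [map_mul, Complex.normSq_eq_norm_sq τ, hτ, one_pow, one_mul]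
    refine this (x := τ * x) (y := τ * y) (z := τ * z) (by rwa [hN]) (by rwa [hN]) (by rwa [hN])
      ?_ ?_ ?_ ?_ ?_
    · rwa [← hN, show τ * (cubeRoot * x + y + z) = cubeRoot * (τ * x) + τ * y + τ * z by ring] at h₁
    · rwa [← hN,
        show τ * (cubeRoot ^ 2 * x + y + z) = cubeRoot ^ 2 * (τ * x) + τ * y + τ * z by ring] at h₂
    · rwa [← hN, show τ * (x + cubeRoot * y + z) = τ * x + cubeRoot * (τ * y) + τ * z by ring] at h₃
    · rwa [← hN,
        show τ * (x + cubeRoot ^ 2 * y + z) = τ * x + cubeRoot ^ 2 * (τ * y) + τ * z by ring] at h₄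
    · rw [show τ * x + τ * y + τ * z = τ * (x + y + z) by ring, hs]
      simp
  obtain ⟨hi, hre⟩ := hr
  rw [cubeRoot_sq] at h₂ h₄
  simp only [cubeRoot, Complex.normSq_apply, Complex.add_re, Complex.add_im, Complex.mul_re,
    Complex.mul_im] at *
  obtain ⟨a, b⟩ := x
  obtain ⟨c, d⟩ := y
  obtain ⟨e, f⟩ := z
  simp only at *
  obtain rfl : f = -b - d := by linarith
  obtain ⟨s, rfl⟩ : ∃ s, e = s - a - c := ⟨a + c + e, by ring⟩
  have hs0 : 0 ≤ s := by linarith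
  have ha : a ≤ 1 := by linarith [mul_self_nonneg (a - 1), mul_self_nonneg b]
  have hc : c ≤ 1 := by linarith [mul_self_nonneg (c - 1), mul_self_nonneg d]
  have he : s - a - c ≤ 1 := by
    linarith [mul_self_nonneg (s - a - c - 1), mul_self_nonneg (-b - d)]
  have hpos : 0 < s := by
    rcases hs0.lt_or_eq with h | rfl
    · exact h
    · have : (0 : ℝ) < 0 := by linear_combination h₁ + (a * a + b * b) / 4 * h3 + 3 * hx
      exact absurd this (lt_irrefl 0)
  have k1 := two_mul_lt_of_both_rotations hpos (by linarith) hx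
    (by linear_combination h₁ + (a * a + b * b) / 4 * h3)
    (by linear_combination h₂ + (a * a + b * b) / 4 * h3)
  have k2 := two_mul_lt_of_both_rotations hpos (by linarith) hy
    (by linear_combination h₃ + (c * c + d * d) / 4 * h3)
    (by linear_combination h₄ + (c * c + d * d) / 4 * h3)
  linarith

/-- The form of `normSq_rotation_le_three` in real coordinates. There `y + z` is rotated to the
number `w ≥ 0`, and `z₁ + i z₂`, `u₁ + i u₂` stand for `-ω (y + ω z)` and `-ω x`. The hypotheses
`hz` and `hz'` say that `y` and `z` lie in the unit disc, and `h₁`, `h₂`, `h₃` that `w` added to any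
of the three rotations of `x` has modulus greater than `√3`. -/
lemma sq_add_sq_le_three_of_triangle {w z₁ z₂ u₁ u₂ : ℝ} (hw0 : 0 ≤ w) (hw2 : w ≤ 2)
    (hz : z₁ * z₁ + z₂ * z₂ - w * z₁ - √3 * w * z₂ + w * w ≤ 3)
    (hz' : z₁ * z₁ + z₂ * z₂ - w * z₁ + √3 * w * z₂ + w * w ≤ 3)
    (hu : u₁ * u₁ + u₂ * u₂ ≤ 1)
    (h₁ : 3 < u₁ * u₁ + u₂ * u₂ - 2 * w * u₁ + w * w)
    (h₂ : 3 < u₁ * u₁ + u₂ * u₂ + w * u₁ - √3 * w * u₂ + w * w)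
    (h₃ : 3 < u₁ * u₁ + u₂ * u₂ + w * u₁ + √3 * w * u₂ + w * w) :
    (z₁ + u₁) * (z₁ + u₁) + (z₂ + u₂) * (z₂ + u₂) ≤ 3 := by
  have h3 := sqrt_three_mul_self
  have hk : 0 < √3 := by positivity
  set k := √3
  -- reflect so that `z₂ ≥ 0`
  wlog hz2 : 0 ≤ z₂ generalizing z₂ u₂
  · have := this (z₂ := -z₂) (u₂ := -u₂) (by linarith) (by linarith) (by linarith) (by linarith)
      (by linarith) (by linarith) (by linarith)
    linarith
  obtain ⟨q, hq⟩ : ∃ q, q = u₁ * u₁ + u₂ * u₂ := ⟨_, rfl⟩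
  obtain ⟨r, hr0, hr⟩ : ∃ r : ℝ, 0 ≤ r ∧ r * r = q :=
    ⟨√q, Real.sqrt_nonneg _, Real.mul_self_sqrt (by rw [hq]; nlinarith)⟩
  rw [← hq, ← hr] at hu h₁ h₂ h₃
  have hr1 : r ≤ 1 := by nlinarith
  have hw1 : 1 < w := by
    have : 2 < w * w := by linarith
    nlinarith
  -- `u` lies in an equilateral triangle about the origin, whose circumradius bounds `r = |u|`
  have hrw : w * r < r * r + w * w - 3 := by
    by_contra! hc
    have hw : 0 < w := by linarith
    have a1 : 2 * u₁ < r := lt_of_mul_lt_mul_left (by linarith : w * (2 * u₁) < w * r) hw0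
    have a2 : k * u₂ - u₁ < r :=
      lt_of_mul_lt_mul_left (by linarith : w * (k * u₂ - u₁) < w * r) hw0
    have a3 : -(k * u₂) - u₁ < r :=
      lt_of_mul_lt_mul_left (by linarith : w * (-(k * u₂) - u₁) < w * r) hw0
    have a4 : 0 < r + u₁ := by linarith
    have a5 : k * u₂ * (k * u₂) = 3 * (u₂ * u₂) := by linear_combination u₂ * u₂ * h3
    have a6 := mul_pos (by linarith : 0 < r + u₁ - k * u₂) (by linarith : 0 < r + u₁ + k * u₂)
    have a7 := mul_pos a4 (by linarith : 0 < r - 2 * u₁)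
    linarith
  have hD : 0 ≤ 12 - 3 * (w * w) := by linarith [mul_self_le_mul_self hw0 hw2]
  obtain ⟨D, hD0, hDD⟩ : ∃ D : ℝ, 0 ≤ D ∧ D * D = 12 - 3 * (w * w) :=
    ⟨√(12 - 3 * (w * w)), Real.sqrt_nonneg _, Real.mul_self_sqrt hD⟩
  -- `X ≥ R` are the two roots of `t² - w t + w² - 3`
  obtain ⟨X, hX⟩ : ∃ X, X = (w + D) / 2 := ⟨_, rfl⟩
  obtain ⟨R, hR⟩ : ∃ R, R = (w - D) / 2 := ⟨_, rfl⟩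
  have hrR : r ≤ R := by
    by_contra! hc
    have hc' : 0 < (2 * r - w) + D := by linarith
    have h5 : 0 < ((2 * r - w) - D) * ((2 * r - w) + D) := by linarith
    have h6 : D < 2 * r - w := by linarith [(pos_iff_pos_of_mul_pos h5).2 hc']
    have h7 : D * D < (2 - w) * (2 - w) := mul_self_lt_mul_self hD0 (by linarith)
    linarith [mul_nonneg (by linarith : 0 ≤ w + 1) (by linarith : 0 ≤ 2 - w)]
  have hz20 : 0 ≤ k * w * z₂ := mul_nonneg (mul_nonneg hk.le hw0) hz2
  have hz1 : z₁ ≤ X := by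
    have : (2 * z₁ - w) ^ 2 ≤ D ^ 2 := by linarith [mul_self_nonneg z₂]
    linarith [(abs_le_of_sq_le_sq' this hD0).2]
  have hn : 0 < w * w - 3 := by
    linarith [mul_nonneg hr0 (by linarith : 0 ≤ w - r)]
  have hXR : X + R = w := by rw [hX, hR]; ring
  have hXRn : X * R = w * w - 3 := by rw [hX, hR]; linear_combination -(1 / 4) * hDD
  have hz10 : 0 ≤ z₁ := by
    refine nonneg_of_mul_nonneg_right (a := w) ?_ (by linarith)
    linarith [mul_self_nonneg z₂, mul_self_nonneg z₁]
  obtain ⟨M, hM⟩ : ∃ M, M = r * r + w * w - 3 := ⟨_, rfl⟩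
  -- the linear functional `u ↦ z·u` on the triangle is bounded by its value at a vertex
  have hin : 2 * w * (z₁ * u₁ + z₂ * u₂) ≤ M * (z₁ + k * z₂) := by
    have b1 : 2 * w * u₁ ≤ M := by linarith
    have b2 : -(w * u₁) + k * w * u₂ ≤ M := by linarith
    have c1 := mul_le_mul_of_nonneg_left b1 hz10
    have c2 := mul_le_mul_of_nonneg_left b1 (mul_nonneg hk.le hz2)
    have c3 := mul_le_mul_of_nonneg_left b2 (mul_nonneg hk.le hz2)
    linear_combination c1 + c2 / 3 + 2 / 3 * c3 - 2 / 3 * w * z₂ * u₂ * h3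
  have hrr : r * r ≤ R * R := mul_self_le_mul_self hr0 hrR
  have hMle : M ≤ w * R := by rw [hM]; linear_combination hrr - hXRn + R * hXR
  have d1 : (w * w + M) * z₁ ≤ (w * w + w * R) * X :=
    mul_le_mul (by linarith) hz1 hz10 (by nlinarith)
  have d2 : 0 ≤ (w * w - M) * (k * z₂) :=
    mul_nonneg (by linarith) (mul_nonneg hk.le hz2)
  have d3 := mul_le_mul_of_nonneg_left hz' hw0
  have d4 := mul_le_mul_of_nonneg_left hrr hw0
  refine le_of_mul_le_mul_left (a := w) ?_ (by linarith)
  have hE : (w * w + w * R) * X + w * (3 - w * w + R * R) = w * 3 := by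
    linear_combination (w * w + w * R) * hXR
  linear_combination d3 + hin + d1 + d2 + d4 + hE - w * hq - w * hr

/-- If every rotation of `x` by a cube root of unity makes `|x + y + z|` greater than `√3`, then
`|x + y + ω z| ≤ √3`. -/
lemma normSq_rotation_le_three {x y z : ℂ} (hx : Complex.normSq x ≤ 1) (hy : Complex.normSq y ≤ 1)
    (hz : Complex.normSq z ≤ 1) (h₁ : 3 < Complex.normSq (x + y + z))
    (h₂ : 3 < Complex.normSq (cubeRoot * x + y + z))
    (h₃ : 3 < Complex.normSq (cubeRoot ^ 2 * x + y + z)) :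
    Complex.normSq (x + y + cubeRoot * z) ≤ 3 := by
  have h3 := sqrt_three_mul_self
  wlog hr : (y + z).im = 0 ∧ 0 ≤ (y + z).re generalizing x y z
  · obtain ⟨τ, hτ, hs⟩ := exists_norm_eq_one_mul_eq_norm (y + z)
    have hN : ∀ w, Complex.normSq (τ * w) = Complex.normSq w := fun w => by
      rw [map_mul, Complex.normSq_eq_norm_sq τ, hτ, one_pow, one_mul]
    rw [← hN, show τ * (x + y + cubeRoot * z) = τ * x + τ * y + cubeRoot * (τ * z) by ring]
    refine this (x := τ * x) (y := τ * y) (z := τ * z) (by rwa [hN]) (by rwa [hN]) (by rwa [hN])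
      ?_ ?_ ?_ ?_
    · rwa [← hN, show τ * (x + y + z) = τ * x + τ * y + τ * z by ring] at h₁
    · rwa [← hN, show τ * (cubeRoot * x + y + z) = cubeRoot * (τ * x) + τ * y + τ * z by ring] at h₂
    · rwa [← hN,
        show τ * (cubeRoot ^ 2 * x + y + z) = cubeRoot ^ 2 * (τ * x) + τ * y + τ * z by ring] at h₃
    · rw [← mul_add, hs]
      simp
  obtain ⟨hi, hre⟩ := hr
  rw [cubeRoot_sq] at h₃
  simp only [cubeRoot, Complex.normSq_apply, Complex.add_re, Complex.add_im, Complex.mul_re,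
    Complex.mul_im] at *
  obtain ⟨a, b⟩ := x
  obtain ⟨c, d⟩ := y
  obtain ⟨e, f⟩ := z
  simp only at *
  obtain rfl : f = -d := by linarith
  obtain ⟨w, rfl⟩ : ∃ w, e = w - c := ⟨c + e, by ring⟩
  have hc : c ≤ 1 := by linarith [mul_self_nonneg (c - 1), mul_self_nonneg d]
  have he : w - c ≤ 1 := by linarith [mul_self_nonneg (w - c - 1), mul_self_nonneg (-d)]
  -- multiply by `-ω`, so that `y + ω z` gets the real part `w / 2`
  have key := sq_add_sq_le_three_of_triangle (w := w) (z₁ := w / 2 + √3 * d)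
    (z₂ := √3 * w / 2 - √3 * c) (u₁ := a / 2 + √3 / 2 * b) (u₂ := b / 2 - √3 / 2 * a)
    (by linarith) (by linarith) ?_ ?_ ?_ ?_ ?_ ?_
  · linear_combination key + ((d * d + (w - c) * (w - c)) / 4
      - (d + b / 2) * (d + b / 2) - (w / 2 - c - a / 2) * (w / 2 - c - a / 2)) * h3
  · linear_combination 3 * hy + (c * c + d * d - w * w / 4) * h3
  · linear_combination 3 * hz + (3 * w * w / 4 - 2 * w * c + c * c + d * d) * h3
  · linear_combination hx + (a * a + b * b) / 4 * h3
  · linear_combination h₂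
  · linear_combination h₁ - ((a * a + b * b) / 4 + w * a / 2) * h3
  · linear_combination h₃ + w * a / 2 * h3

/-! ### A covering problem in the group `(ℤ/3)²` -/

/-- The restrictions on a set `B` of points `(i, j)` of `(ℤ/3)²` at which
`|x + ω^i y + ω^j z| > √3` for fixed `x`, `y`, `z` in the unit disc. Rotating one of the three
summands by `ω` moves `(i, j)` by `(2, 2)`, `(1, 0)` or `(0, 1)`. The set `B` contains no line of
the remaining direction `(1, 2)`, does not contain the four neighbours of a point in two of the
three directions, and, if it contains a line of one of the three directions, nothing else. -/
def IsAdmissible (B : Fin 3 → Fin 3 → Bool) : Prop := ∀ i j,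
  ¬(B i j ∧ B (i + 1) (j + 2) ∧ B (i + 2) (j + 1)) ∧
  ¬(B (i + 1) j ∧ B (i + 2) j ∧ B i (j + 1) ∧ B i (j + 2)) ∧
  ¬(B (i + 1) j ∧ B (i + 2) j ∧ B (i + 1) (j + 1) ∧ B (i + 2) (j + 2)) ∧
  ¬(B i (j + 1) ∧ B i (j + 2) ∧ B (i + 1) (j + 1) ∧ B (i + 2) (j + 2)) ∧
  ¬(B i j ∧ B (i + 1) j ∧ B (i + 2) j ∧ (B i (j + 1) ∨ B i (j + 2))) ∧
  ¬(B i j ∧ B i (j + 1) ∧ B i (j + 2) ∧ (B (i + 1) j ∨ B (i + 2) j)) ∧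
  ¬(B i j ∧ B (i + 1) (j + 1) ∧ B (i + 2) (j + 2) ∧ (B (i + 1) j ∨ B (i + 2) j))

instance (B : Fin 3 → Fin 3 → Bool) : Decidable (IsAdmissible B) := by
  unfold IsAdmissible; infer_instance

lemma IsAdmissible.mono {B B' : Fin 3 → Fin 3 → Bool} (hB : IsAdmissible B)
    (h : ∀ i j, B' i j → B i j) : IsAdmissible B' := by
  intro i j
  obtain ⟨h1, h2, h3, h4, h5, h6, h7⟩ := hB i j
  refine ⟨?_, ?_, ?_, ?_, ?_, ?_, ?_⟩
  · exact fun ⟨a, b, c⟩ => h1 ⟨h _ _ a, h _ _ b, h _ _ c⟩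
  · exact fun ⟨a, b, c, d⟩ => h2 ⟨h _ _ a, h _ _ b, h _ _ c, h _ _ d⟩
  · exact fun ⟨a, b, c, d⟩ => h3 ⟨h _ _ a, h _ _ b, h _ _ c, h _ _ d⟩
  · exact fun ⟨a, b, c, d⟩ => h4 ⟨h _ _ a, h _ _ b, h _ _ c, h _ _ d⟩
  · exact fun ⟨a, b, c, d⟩ => h5 ⟨h _ _ a, h _ _ b, h _ _ c, d.imp (h _ _) (h _ _)⟩
  · exact fun ⟨a, b, c, d⟩ => h6 ⟨h _ _ a, h _ _ b, h _ _ c, d.imp (h _ _) (h _ _)⟩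
  · exact fun ⟨a, b, c, d⟩ => h7 ⟨h _ _ a, h _ _ b, h _ _ c, d.imp (h _ _) (h _ _)⟩

set_option maxRecDepth 100000 in
lemma not_isAdmissible_and_compl (a b c d e f g h : Bool) :
    ¬(IsAdmissible ![![false, a, b], ![c, d, e], ![f, g, h]] ∧
      IsAdmissible ![![false, !a, !b], ![!c, !d, !e], ![!f, !g, !h]]) := by
  revert a b c d e f g h
  decide +kernel

/-- Two admissible sets and one more point cannot cover `(ℤ/3)²`. -/
lemma IsAdmissible.exists_not_mem {B B' : Fin 3 → Fin 3 → Bool} (hB : IsAdmissible B)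
    (hB' : IsAdmissible B') : ∃ i j, (i ≠ 0 ∨ j ≠ 0) ∧ ¬B i j ∧ ¬B' i j := by
  by_contra! hc
  refine not_isAdmissible_and_compl (B 0 1) (B 0 2) (B 1 0) (B 1 1) (B 1 2) (B 2 0) (B 2 1) (B 2 2)
    ⟨hB.mono ?_, hB'.mono ?_⟩
  · intro i j
    fin_cases i <;> fin_cases j <;> simp
  · intro i j
    have := hc i j
    fin_cases i <;> fin_cases j <;> simp at this ⊢ <;> exact this

lemma normSq_cubeRootPow_mul (i : Fin 3) (x : ℂ) :
    Complex.normSq (cubeRootPow i * x) = Complex.normSq x := by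
  rw [map_mul, Complex.normSq_eq_norm_sq (cubeRootPow i), norm_cubeRootPow, one_pow, one_mul]

lemma normSq_cubeRoot_sq_mul (x : ℂ) :
    Complex.normSq (cubeRoot ^ 2 * x) = Complex.normSq x := by
  rw [pow_two, mul_assoc, normSq_cubeRoot_mul, normSq_cubeRoot_mul]

/-- The three kinds of restrictions of `IsAdmissible` are Parseval's identity, `not_both_rotations`
and `normSq_rotation_le_three`, applied to the summands in each order. -/
lemma isAdmissible_normSq {x y z : ℂ} (hx : Complex.normSq x ≤ 1) (hy : Complex.normSq y ≤ 1)
    (hz : Complex.normSq z ≤ 1) :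
    IsAdmissible fun i j =>
      decide (3 < Complex.normSq (x + cubeRootPow i * y + cubeRootPow j * z)) := by
  intro i j
  simp only [decide_eq_true_eq, cubeRootPow_add_one, cubeRootPow_add_two, mul_assoc]
  rw [← normSq_cubeRootPow_mul i] at hy
  rw [← normSq_cubeRootPow_mul j] at hz
  generalize cubeRootPow i * y = y at *
  generalize cubeRootPow j * z = z at *
  have hc := cubeRoot_cube
  set ω := cubeRoot
  -- rotating `x` is the same as rotating `y` and `z` backwards
  have e1 : Complex.normSq (x + ω * y + ω * z) = Complex.normSq (ω ^ 2 * x + y + z) := by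
    rw [← normSq_cubeRoot_mul (ω ^ 2 * x + y + z)]
    congr 1; linear_combination -x * hc
  have e2 : Complex.normSq (x + ω ^ 2 * y + ω ^ 2 * z) = Complex.normSq (ω * x + y + z) := by
    rw [← normSq_cubeRoot_sq_mul (ω * x + y + z)]
    congr 1; linear_combination -x * hc
  have e3 : Complex.normSq (x + ω ^ 2 * y + z) = Complex.normSq (ω * x + y + ω * z) := by
    rw [← normSq_cubeRoot_sq_mul (ω * x + y + ω * z)]
    congr 1; linear_combination (-x - z) * hc
  have e4 : Complex.normSq (x + y + ω ^ 2 * z) = Complex.normSq (ω * x + z + ω * y) := by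
    rw [← normSq_cubeRoot_sq_mul (ω * x + z + ω * y)]
    congr 1; linear_combination (-x - y) * hc
  have s (p q r : ℂ) : q + p + r = p + q + r := by ring
  have s' (p q r : ℂ) : p + q + r = r + p + q := by ring
  have hωx : Complex.normSq (ω * x) ≤ 1 := by rwa [normSq_cubeRoot_mul]
  have hωy : Complex.normSq (ω * y) ≤ 1 := by rwa [normSq_cubeRoot_mul]
  have hωz : Complex.normSq (ω * z) ≤ 1 := by rwa [normSq_cubeRoot_mul]
  refine ⟨?_, ?_, ?_, ?_, ?_, ?_, ?_⟩
  · rintro ⟨h1, h2, h3⟩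
    linarith [normSq_add_normSq_add_normSq x y z]
  · rintro ⟨h1, h2, h3, h4⟩
    refine not_both_rotations (x := y) (y := z) (z := x) hy hz hx ?_ ?_ ?_ ?_
    · rwa [s']
    · rwa [s']
    · rwa [s']
    · rwa [s']
  · rintro ⟨h1, h2, h3, h4⟩
    rw [e1] at h3
    rw [e2] at h4
    exact not_both_rotations hx hy hz h4 h3 h1 h2
  · rintro ⟨h1, h2, h3, h4⟩
    rw [e1] at h3
    rw [e2] at h4
    refine not_both_rotations (x := x) (y := z) (z := y) hx hz hy ?_ ?_ ?_ ?_
    · rwa [add_right_comm]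
    · rwa [add_right_comm]
    · rwa [add_right_comm]
    · rwa [add_right_comm]
  · rintro ⟨h1, h2, h3, h4 | h4⟩
    · refine h4.not_ge ?_
      rw [s]
      exact normSq_rotation_le_three hy hx hz (by rwa [s]) (by rwa [s]) (by rwa [s])
    · refine h4.not_ge ?_
      rw [e4, show ω * x + z + ω * y = ω * y + z + ω * x by ring]
      refine normSq_rotation_le_three hωy hz hx ?_ ?_ ?_
      · rwa [show ω * y + z + x = x + ω * y + z by ring]
      · rwa [show ω * (ω * y) + z + x = x + ω ^ 2 * y + z by ring]
      · rwa [show ω ^ 2 * (ω * y) + z + x = x + y + z by linear_combination y * hc]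
  · rintro ⟨h1, h2, h3, h4 | h4⟩
    · refine h4.not_ge ?_
      rw [show x + ω * y + z = z + x + ω * y by ring]
      refine normSq_rotation_le_three hz hx hy ?_ ?_ ?_
      · rwa [← s']
      · rwa [← s']
      · rwa [← s']
    · refine h4.not_ge ?_
      rw [e3, show ω * x + y + ω * z = ω * z + y + ω * x by ring]
      refine normSq_rotation_le_three hωz hy hx ?_ ?_ ?_
      · rwa [show ω * z + y + x = x + y + ω * z by ring]
      · rwa [show ω * (ω * z) + y + x = x + y + ω ^ 2 * z by ring]
      · rwa [show ω ^ 2 * (ω * z) + y + x = x + y + z by linear_combination z * hc]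
  · rintro ⟨h1, h2, h3, h4 | h4⟩
    · rw [e1] at h2
      rw [e2] at h3
      refine h4.not_ge ?_
      rw [add_right_comm]
      refine normSq_rotation_le_three hx hz hy ?_ ?_ ?_
      · rwa [add_right_comm]
      · rwa [add_right_comm]
      · rwa [add_right_comm]
    · rw [e1] at h2
      rw [e2] at h3
      refine h4.not_ge ?_
      rw [e3]
      refine normSq_rotation_le_three hωx hy hz h3 ?_ ?_
      · rwa [← mul_assoc, ← pow_two]
      · rwa [← mul_assoc, ← pow_succ, hc, one_mul]

/-- Three complex numbers of prescribed moduli, which satisfy the triangle inequalities, may sum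
to zero. -/
lemma exists_sum_eq_zero_of_triangle {r s t : ℝ} (hs : 0 ≤ s) (ht : 0 ≤ t)
    (h₁ : r ≤ s + t) (h₂ : s ≤ r + t) (h₃ : t ≤ r + s) :
    ∃ x y z : ℂ, ‖x‖ = r ∧ ‖y‖ = s ∧ ‖z‖ = t ∧ x + y + z = 0 := by
  have hcont : Continuous fun θ : ℝ => ‖(s : ℂ) + t * Complex.exp (θ * Complex.I)‖ := by fun_prop
  have h0 : ‖(s : ℂ) + t * Complex.exp ((0 : ℝ) * Complex.I)‖ = s + t := by
    rw [Complex.ofReal_zero, zero_mul, Complex.exp_zero, mul_one, ← Complex.ofReal_add,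
      Complex.norm_of_nonneg (by positivity)]
  have hπ : ‖(s : ℂ) + t * Complex.exp ((Real.pi : ℝ) * Complex.I)‖ = |s - t| := by
    rw [Complex.exp_pi_mul_I, mul_neg_one, ← sub_eq_add_neg, ← Complex.ofReal_sub,
      Complex.norm_real, Real.norm_eq_abs]
  obtain ⟨θ, -, hθ⟩ := intermediate_value_Icc' Real.pi_pos.le hcont.continuousOn
    (show r ∈ Set.Icc _ _ from ⟨by
      simp only [hπ]; exact abs_le.2 ⟨by linarith, by linarith⟩, by simp only [h0]; exact h₁⟩)
  refine ⟨-((s : ℂ) + t * Complex.exp (θ * Complex.I)), s, t * Complex.exp (θ * Complex.I), ?_,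
    Complex.norm_of_nonneg hs, ?_, by ring⟩
  · rw [norm_neg]; exact hθ
  · rw [norm_mul, Complex.norm_exp_ofReal_mul_I, mul_one, Complex.norm_of_nonneg ht]

/-! ### Choosing the phases of one row -/

lemma normSq_cubeRoot_sub_one_mul (z : ℂ) :
    Complex.normSq ((cubeRoot - 1) * z) = 3 * Complex.normSq z := by
  rw [map_mul]
  congr 1
  have h := sqrt_three_mul_self
  simp only [cubeRoot, Complex.normSq_apply, Complex.sub_re, Complex.sub_im, Complex.one_re,
    Complex.one_im]
  linear_combination 1 / 4 * h

lemma normSq_cubeRoot_sq_sub_one_mul (z : ℂ) :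
    Complex.normSq ((cubeRoot ^ 2 - 1) * z) = 3 * Complex.normSq z := by
  rw [← normSq_cubeRoot_sub_one_mul, ← normSq_cubeRoot_mul, ← Complex.normSq_neg]
  congr 1
  linear_combination -z * cubeRoot_cube

/-- Of three directions at angles of `120°` to each other, one makes an angle of at most `60°` with
a given vector. For two vectors longer than `√3` this makes the corresponding sum longer than
`3`. -/
lemma not_normSq_add_rotation_le {y z : ℂ} (hy : 3 < Complex.normSq y) (hz : 3 < Complex.normSq z)
    (h₁ : Complex.normSq (y + z) ≤ 9) (h₂ : Complex.normSq (y + cubeRoot * z) ≤ 9)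
    (h₃ : Complex.normSq (y + cubeRoot ^ 2 * z) ≤ 9) : False := by
  have h3 := sqrt_three_mul_self
  have hyz := mul_lt_mul'' hy hz (by norm_num) (by norm_num)
  rw [cubeRoot_sq] at h₃
  simp only [cubeRoot, Complex.normSq_apply, Complex.add_re, Complex.add_im, Complex.mul_re,
    Complex.mul_im] at *
  obtain ⟨a, b⟩ := y
  obtain ⟨c, d⟩ := z
  simp only at *
  -- `p + i q = y * conj z`
  obtain ⟨p, hp⟩ : ∃ p, p = a * c + b * d := ⟨_, rfl⟩
  obtain ⟨q, hq⟩ : ∃ q, q = b * c - a * d := ⟨_, rfl⟩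
  have hpq : 9 < p * p + q * q := by rw [hp, hq]; linarith
  have b1 : 2 * p < 3 := by rw [hp]; linarith
  have b2 : √3 * q < 3 + p := by
    rw [hp, hq]; linear_combination h₂ + hy + hz - (c * c + d * d) / 4 * h3
  have b3 : -(√3 * q) < 3 + p := by
    rw [hp, hq]; linear_combination h₃ + hy + hz - (c * c + d * d) / 4 * h3
  have a5 : √3 * q * (√3 * q) = 3 * (q * q) := by linear_combination q * q * h3
  have a6 := mul_pos (by linarith : 0 < 3 + p - √3 * q) (by linarith : 0 < 3 + p + √3 * q)
  have a7 := mul_pos (by linarith : 0 < 3 + p) (by linarith : 0 < 3 - 2 * p)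
  linarith

lemma norm_cubeRootPow_sub_le (i j : Fin 3) : ‖cubeRootPow i - cubeRootPow j‖ ≤ √3 := by
  have h1 : ‖cubeRoot - 1‖ = √3 := by
    have := normSq_cubeRoot_sub_one_mul 1
    rw [mul_one, Complex.normSq_eq_norm_sq, map_one, mul_one] at this
    rw [← this, Real.sqrt_sq (norm_nonneg _)]
  have h2 : ‖cubeRoot ^ 2 - 1‖ = √3 := by
    have := normSq_cubeRoot_sq_sub_one_mul 1
    rw [mul_one, Complex.normSq_eq_norm_sq, map_one, mul_one] at this
    rw [← this, Real.sqrt_sq (norm_nonneg _)]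
  have h3 : ‖cubeRoot ^ 2 - cubeRoot‖ = √3 := by
    rw [show cubeRoot ^ 2 - cubeRoot = cubeRoot * (cubeRoot - 1) by ring, norm_mul, norm_cubeRoot,
      one_mul, h1]
  fin_cases i <;> fin_cases j <;>
    simp [cubeRootPow, h1, h2, h3, norm_sub_rev (1 : ℂ), norm_sub_rev cubeRoot (cubeRoot ^ 2)]

/-- If one of three moduli is at least the sum of the others, then opposite phases give a sum of
modulus at most `√3` under all rotations by cube roots of unity. -/
lemma normSq_le_three_of_add_le {r s t : ℝ} (hs : 0 ≤ s) (ht : 0 ≤ t) (hr : r ≤ 1)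
    (h : s + t ≤ r) (i j k : Fin 3) :
    Complex.normSq (cubeRootPow i * r - cubeRootPow j * s - cubeRootPow k * t) ≤ 3 := by
  have hle : ‖cubeRootPow i * r - cubeRootPow j * s - cubeRootPow k * t‖ ≤ √3 := by
    have h1 : (1 : ℝ) ≤ √3 := Real.one_le_sqrt.2 (by norm_num)
    calc _ = ‖((r - s - t : ℝ) : ℂ) * cubeRootPow i + s * (cubeRootPow i - cubeRootPow j)
          + t * (cubeRootPow i - cubeRootPow k)‖ := by congr 1; push_cast; ring
      _ ≤ (r - s - t) * 1 + s * √3 + t * √3 := by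
        refine (norm_add₃_le).trans ?_
        rw [norm_mul, norm_mul, norm_mul, norm_cubeRootPow, Complex.norm_of_nonneg hs,
          Complex.norm_of_nonneg ht, Complex.norm_of_nonneg (by linarith)]
        gcongr <;> exact norm_cubeRootPow_sub_le _ _
      _ ≤ √3 := by nlinarith
  rw [Complex.normSq_eq_norm_sq]
  calc _ ≤ √3 ^ 2 := by gcongr
    _ = 3 := Real.sq_sqrt (by norm_num)

/-- Three complex numbers of prescribed moduli `r, s, t ≤ 1` can be chosen so that the modulus of
`x + ω^i y + ω^j z` exceeds `√3` at most for `i = j = 0`. If the moduli satisfy the triangle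
inequalities, this holds up to a shift of `(i, j)` for `x + y + z = 0`. -/
lemma exists_normSq_le_three_of_ne_zero {r s t : ℝ} (hr : 0 ≤ r) (hs : 0 ≤ s) (ht : 0 ≤ t)
    (hr1 : r ≤ 1) (hs1 : s ≤ 1) (ht1 : t ≤ 1) :
    ∃ x y z : ℂ, ‖x‖ = r ∧ ‖y‖ = s ∧ ‖z‖ = t ∧ ∀ i j, i ≠ 0 ∨ j ≠ 0 →
      Complex.normSq (x + cubeRootPow i * y + cubeRootPow j * z) ≤ 3 := by
  have hneg {p : ℝ} (hp : 0 ≤ p) : ‖(-p : ℂ)‖ = p := by rw [norm_neg, Complex.norm_of_nonneg hp]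
  rcases lt_or_ge (s + t) r with h₁ | h₁
  · refine ⟨r, -s, -t, Complex.norm_of_nonneg hr, hneg hs, hneg ht, fun i j _ => ?_⟩
    rw [show (r : ℂ) + cubeRootPow i * -s + cubeRootPow j * -t
      = cubeRootPow 0 * r - cubeRootPow i * s - cubeRootPow j * t by rw [cubeRootPow_zero]; ring]
    exact normSq_le_three_of_add_le hs ht hr1 h₁.le _ _ _
  rcases lt_or_ge (r + t) s with h₂ | h₂
  · refine ⟨-r, s, -t, hneg hr, Complex.norm_of_nonneg hs, hneg ht, fun i j _ => ?_⟩
    rw [show (-r : ℂ) + cubeRootPow i * s + cubeRootPow j * -t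
      = cubeRootPow i * s - cubeRootPow 0 * r - cubeRootPow j * t by rw [cubeRootPow_zero]; ring]
    exact normSq_le_three_of_add_le hr ht hs1 h₂.le _ _ _
  rcases lt_or_ge (r + s) t with h₃ | h₃
  · refine ⟨-r, -s, t, hneg hr, hneg hs, Complex.norm_of_nonneg ht, fun i j _ => ?_⟩
    rw [show (-r : ℂ) + cubeRootPow i * -s + cubeRootPow j * t
      = cubeRootPow j * t - cubeRootPow 0 * r - cubeRootPow i * s by rw [cubeRootPow_zero]; ring]
    exact normSq_le_three_of_add_le hr hs ht1 h₃.le _ _ _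
  obtain ⟨x, y, z, hx, hy, hz, hsum⟩ := exists_sum_eq_zero_of_triangle hs ht h₁ h₂ h₃
  have hN {p : ℝ} {w : ℂ} (h0 : 0 ≤ p) (h1 : p ≤ 1) (hw : ‖w‖ = p) : Complex.normSq w ≤ 1 := by
    rw [Complex.normSq_eq_norm_sq, hw]; nlinarith
  have hx1 := hN hr hr1 hx
  have hy1 := hN hs hs1 hy
  have hz1 := hN ht ht1 hz
  have hc := cubeRoot_cube
  have hw := one_add_cubeRoot_add_sq
  -- the six points outside the line through `(0, 0)` and `(1, 2)`
  have g01 : Complex.normSq (x + y + cubeRoot * z) ≤ 3 := by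
    rw [show x + y + cubeRoot * z = (cubeRoot - 1) * z by linear_combination hsum,
      normSq_cubeRoot_sub_one_mul]
    linarith
  have g02 : Complex.normSq (x + y + cubeRoot ^ 2 * z) ≤ 3 := by
    rw [show x + y + cubeRoot ^ 2 * z = (cubeRoot ^ 2 - 1) * z by linear_combination hsum,
      normSq_cubeRoot_sq_sub_one_mul]
    linarith
  have g10 : Complex.normSq (x + cubeRoot * y + z) ≤ 3 := by
    rw [show x + cubeRoot * y + z = (cubeRoot - 1) * y by linear_combination hsum,
      normSq_cubeRoot_sub_one_mul]
    linarith
  have g20 : Complex.normSq (x + cubeRoot ^ 2 * y + z) ≤ 3 := by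
    rw [show x + cubeRoot ^ 2 * y + z = (cubeRoot ^ 2 - 1) * y by linear_combination hsum,
      normSq_cubeRoot_sq_sub_one_mul]
    linarith
  have g11 : Complex.normSq (x + cubeRoot * y + cubeRoot * z) ≤ 3 := by
    rw [show x + cubeRoot * y + cubeRoot * z = -((cubeRoot - 1) * x) by
      linear_combination cubeRoot * hsum, Complex.normSq_neg, normSq_cubeRoot_sub_one_mul]
    linarith
  have g22 : Complex.normSq (x + cubeRoot ^ 2 * y + cubeRoot ^ 2 * z) ≤ 3 := by
    rw [show x + cubeRoot ^ 2 * y + cubeRoot ^ 2 * z = -((cubeRoot ^ 2 - 1) * x) by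
      linear_combination cubeRoot ^ 2 * hsum, Complex.normSq_neg, normSq_cubeRoot_sq_sub_one_mul]
    linarith
  have g00 : Complex.normSq (x + y + z) ≤ 3 := by rw [hsum]; norm_num
  have hmod {w : ℂ} : ‖cubeRoot * w‖ = ‖w‖ := by rw [norm_mul, norm_cubeRoot, one_mul]
  have hmod2 {w : ℂ} : ‖cubeRoot ^ 2 * w‖ = ‖w‖ := by
    rw [norm_mul, norm_pow, norm_cubeRoot, one_pow, one_mul]
  by_cases hA : Complex.normSq (x + cubeRoot * y + cubeRoot ^ 2 * z) ≤ 3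
  · refine ⟨x, cubeRoot ^ 2 * y, cubeRoot * z, hx, by rw [hmod2, hy], by rw [hmod, hz], ?_⟩
    have k1 : cubeRoot * (cubeRoot ^ 2 * y) = y := by linear_combination y * hc
    have k2 : cubeRoot ^ 2 * (cubeRoot ^ 2 * y) = cubeRoot * y := by
      linear_combination cubeRoot * y * hc
    have k3 : cubeRoot * (cubeRoot * z) = cubeRoot ^ 2 * z := by ring
    have k4 : cubeRoot ^ 2 * (cubeRoot * z) = z := by linear_combination z * hc
    intro i j hij
    fin_cases i <;> fin_cases j <;>
      simp [cubeRootPow, k1, k2, k3, k4] at hij ⊢ <;> assumption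
  · have hB : Complex.normSq (x + cubeRoot ^ 2 * y + cubeRoot * z) ≤ 3 := by
      by_contra! hB
      push Not at hA
      refine not_normSq_add_rotation_le hA hB ?_ ?_ ?_
      · rw [show x + cubeRoot * y + cubeRoot ^ 2 * z + (x + cubeRoot ^ 2 * y + cubeRoot * z)
          = 3 * x by linear_combination (y + z) * hw - hsum, map_mul]
        norm_num [Complex.normSq_apply] at hx1 ⊢
        linarith
      · rw [show x + cubeRoot * y + cubeRoot ^ 2 * z
          + cubeRoot * (x + cubeRoot ^ 2 * y + cubeRoot * z) = 3 * (cubeRoot ^ 2 * z) by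
            linear_combination (x + y) * hw + y * hc - cubeRoot ^ 2 * hsum, map_mul,
          normSq_cubeRoot_sq_mul]
        norm_num [Complex.normSq_apply] at hz1 ⊢
        linarith
      · rw [show x + cubeRoot * y + cubeRoot ^ 2 * z
          + cubeRoot ^ 2 * (x + cubeRoot ^ 2 * y + cubeRoot * z) = 3 * (cubeRoot * y) by
            linear_combination (x + z) * hw + (cubeRoot * y + z) * hc - cubeRoot * hsum, map_mul,
          normSq_cubeRoot_mul]
        norm_num [Complex.normSq_apply] at hy1 ⊢
        linarith
    refine ⟨x, cubeRoot * y, cubeRoot ^ 2 * z, hx, by rw [hmod, hy], by rw [hmod2, hz], ?_⟩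
    have k1 : cubeRoot * (cubeRoot * y) = cubeRoot ^ 2 * y := by ring
    have k2 : cubeRoot ^ 2 * (cubeRoot * y) = y := by linear_combination y * hc
    have k3 : cubeRoot * (cubeRoot ^ 2 * z) = z := by linear_combination z * hc
    have k4 : cubeRoot ^ 2 * (cubeRoot ^ 2 * z) = cubeRoot * z := by
      linear_combination cubeRoot * z * hc
    intro i j hij
    fin_cases i <;> fin_cases j <;>
      simp [cubeRootPow, k1, k2, k3, k4] at hij ⊢ <;> assumption

/-! ### Balancing two or three vectors -/

lemma exists_norm_eq_one_mul_conj_eq {a c : ℂ} (h : ‖c‖ = ‖a‖) :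
    ∃ x : ℂ, ‖x‖ = 1 ∧ x * (starRingEnd ℂ) a = c := by
  rcases eq_or_ne a 0 with rfl | ha
  · exact ⟨1, by simp, by simpa [eq_comm] using h⟩
  · have ha' : (starRingEnd ℂ) a ≠ 0 := (map_ne_zero _).2 ha
    refine ⟨c / (starRingEnd ℂ) a, ?_, div_mul_cancel₀ _ ha'⟩
    rw [norm_div, Complex.norm_conj, h, div_self (norm_ne_zero_iff.2 ha)]

/-- Balancing three vectors of the unit ball of `ℓ_∞^3`. -/
lemma exists_isUnimodular_norm_stdInner_le_three (a : Fin 3 → (Fin 3 → ℂ)) (ha : ∀ i, ‖a i‖ ≤ 1) :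
    ∃ x : Fin 3 → ℂ, IsUnimodular x ∧ ∀ i, ‖stdInner x (a i)‖ ≤ √3 := by
  have haij (i j) : ‖a i j‖ ≤ 1 := (norm_le_pi_norm (a i) j).trans (ha i)
  obtain ⟨c₀, c₁, c₂, h₀, h₁, h₂, hc⟩ := exists_normSq_le_three_of_ne_zero (norm_nonneg (a 0 0))
    (norm_nonneg (a 0 1)) (norm_nonneg (a 0 2)) (haij 0 0) (haij 0 1) (haij 0 2)
  obtain ⟨x₀, hx₀, rfl⟩ := exists_norm_eq_one_mul_conj_eq h₀
  obtain ⟨x₁, hx₁, rfl⟩ := exists_norm_eq_one_mul_conj_eq h₁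
  obtain ⟨x₂, hx₂, rfl⟩ := exists_norm_eq_one_mul_conj_eq h₂
  have hN (i j) {x : ℂ} (hx : ‖x‖ = 1) : Complex.normSq (x * (starRingEnd ℂ) (a i j)) ≤ 1 := by
    rw [Complex.normSq_eq_norm_sq, norm_mul, hx, one_mul, Complex.norm_conj]
    exact pow_le_one₀ (norm_nonneg _) (haij i j)
  obtain ⟨i, j, hij, hi, hj⟩ :=
    (isAdmissible_normSq (hN 1 0 hx₀) (hN 1 1 hx₁) (hN 1 2 hx₂)).exists_not_mem
      (isAdmissible_normSq (hN 2 0 hx₀) (hN 2 1 hx₁) (hN 2 2 hx₂))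
  rw [decide_eq_true_eq, not_lt] at hi hj
  have h0 := hc i j hij
  refine ⟨![x₀, cubeRootPow i * x₁, cubeRootPow j * x₂], fun k => ?_, fun k => ?_⟩
  · fin_cases k <;> simp [norm_cubeRootPow, hx₀, hx₁, hx₂]
  · apply Real.le_sqrt_of_sq_le
    rw [← Complex.normSq_eq_norm_sq]
    fin_cases k <;> simpa [stdInner, Fin.sum_univ_three, mul_assoc]

/-- Two complex numbers can be rotated simultaneously into a closed half plane. -/
lemma exists_norm_eq_one_re_mul_nonpos (k l : ℂ) :
    ∃ z : ℂ, ‖z‖ = 1 ∧ (k * z).re ≤ 0 ∧ (l * z).re ≤ 0 := by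
  obtain ⟨τ, hτ, hk⟩ := exists_norm_eq_one_mul_eq_norm k
  rcases le_total 0 (l * τ).im with h | h
  · refine ⟨τ * Complex.I, by simp [hτ], ?_, ?_⟩
    · rw [← mul_assoc, mul_comm k, hk]; simp
    · rw [← mul_assoc, Complex.mul_I_re]; linarith
  · refine ⟨τ * -Complex.I, by simp [hτ], ?_, ?_⟩
    · rw [← mul_assoc, mul_comm k, hk]; simp
    · rw [← mul_assoc, mul_neg, Complex.neg_re, Complex.mul_I_re]; linarith

/-- Balancing two vectors of the unit ball of `ℓ_∞^2`. -/
lemma exists_isUnimodular_norm_stdInner_le_two (a : Fin 2 → (Fin 2 → ℂ)) (ha : ∀ i, ‖a i‖ ≤ 1) :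
    ∃ x : Fin 2 → ℂ, IsUnimodular x ∧ ∀ i, ‖stdInner x (a i)‖ ≤ √2 := by
  have haij (i j) : ‖a i j‖ ≤ 1 := (norm_le_pi_norm (a i) j).trans (ha i)
  obtain ⟨z, hz, h₀, h₁⟩ := exists_norm_eq_one_re_mul_nonpos
    (a 0 0 * (starRingEnd ℂ) (a 0 1)) (a 1 0 * (starRingEnd ℂ) (a 1 1))
  have key (i) (h : (a i 0 * (starRingEnd ℂ) (a i 1) * z).re ≤ 0) :
      ‖stdInner ![1, z] (a i)‖ ≤ √2 := by
    apply Real.le_sqrt_of_sq_le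
    have e : stdInner ![1, z] (a i)
        = (starRingEnd ℂ) (a i 0) + z * (starRingEnd ℂ) (a i 1) := by
      simp [stdInner, Fin.sum_univ_two]
    rw [e, ← Complex.normSq_eq_norm_sq, Complex.normSq_add, map_mul, Complex.normSq_conj,
      Complex.normSq_conj, Complex.normSq_eq_norm_sq, Complex.normSq_eq_norm_sq z, hz,
      Complex.normSq_eq_norm_sq]
    have e2 : ((starRingEnd ℂ) (a i 0) * (starRingEnd ℂ) (z * (starRingEnd ℂ) (a i 1))).re
        = (a i 0 * (starRingEnd ℂ) (a i 1) * z).re := by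
      rw [← map_mul, Complex.conj_re]; congr 1; ring
    have b0 := pow_le_one₀ (n := 2) (norm_nonneg _) (haij i 0)
    have b1 := pow_le_one₀ (n := 2) (norm_nonneg _) (haij i 1)
    rw [e2]
    linarith
  refine ⟨![1, z], fun k => ?_, fun k => ?_⟩
  · fin_cases k <;> simp [hz]
  · fin_cases k
    · exact key 0 h₀
    · exact key 1 h₁

/-! ### Character tables and the distance between `ℓ_1^n` and `ℓ_∞^n` -/

/-- The character table of `ℤ/2` or `ℤ/3`: a matrix with entries of modulus one which is a multiple
of an isometry of the Euclidean norm. -/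
lemma exists_flat_isometry {n : ℕ} (hn : n = 2 ∨ n = 3) : ∃ U : Fin n → Fin n → ℂ,
    (∀ i j, ‖U i j‖ = 1) ∧ ∀ x : Fin n → ℂ,
      ∑ i, Complex.normSq (∑ j, x j * U i j) = n * ∑ j, Complex.normSq (x j) := by
  rcases hn with rfl | rfl
  · refine ⟨![![1, 1], ![1, -1]], fun i j => ?_, fun x => ?_⟩
    · fin_cases i <;> fin_cases j <;> simp
    · simp [Fin.sum_univ_two, Complex.normSq_apply]
      ring
  · refine ⟨![![1, 1, 1], ![1, cubeRoot, cubeRoot ^ 2], ![1, cubeRoot ^ 2, cubeRoot]],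
      fun i j => ?_, fun x => ?_⟩
    · fin_cases i <;> fin_cases j <;> simp [norm_cubeRoot]
    · have := normSq_add_normSq_add_normSq (x 0) (x 1) (x 2)
      simp only [Fin.sum_univ_three]
      simp [mul_comm (x _)]
      exact this

/-- The rows of a character table cannot be balanced better: by Parseval's identity the mean of
`|⟨x, a i⟩|²` over `i` is `n` for every unimodular `x`. -/
lemma exists_sqrt_le_norm_stdInner {n : ℕ} (hn : n = 2 ∨ n = 3) :
    ∃ a : Fin n → (Fin n → ℂ), (∀ i, ‖a i‖ ≤ 1) ∧
      ∀ x : Fin n → ℂ, IsUnimodular x → ∃ i, √(n : ℝ) ≤ ‖stdInner x (a i)‖ := by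
  obtain ⟨U, hU, hUx⟩ := exists_flat_isometry hn
  refine ⟨fun i j => (starRingEnd ℂ) (U i j), fun i => ?_, fun x hx => ?_⟩
  · exact (pi_norm_le_iff_of_nonneg zero_le_one).2 fun j => by rw [Complex.norm_conj, hU]
  · by_contra! hc
    have hlt : ∑ i : Fin n, Complex.normSq (∑ j, x j * U i j) < ∑ _i : Fin n, (n : ℝ) := by
      apply Finset.sum_lt_sum_of_nonempty
      · exact ⟨⟨0, by omega⟩, Finset.mem_univ _⟩
      · intro i _
        have := hc i
        simp only [stdInner, Complex.conj_conj] at this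
        rw [Complex.normSq_eq_norm_sq]
        exact (Real.lt_sqrt (norm_nonneg _)).1 this
    rw [hUx] at hlt
    simp [Complex.normSq_eq_norm_sq, hx _] at hlt

section BanachMazur

variable {X Y : Type*} [NormedAddCommGroup X] [NormedSpace ℂ X] [NormedAddCommGroup Y]
  [NormedSpace ℂ Y]

/-- An operator with two-sided bounds between spaces of the same dimension bounds the
Banach–Mazur distance from above. -/
lemma banachMazurDist_le_of_bounds [FiniteDimensional ℂ X] [FiniteDimensional ℂ Y]
    (hXY : Module.finrank ℂ X = Module.finrank ℂ Y) (T : X →ₗ[ℂ] Y) {C D : ℝ} (hC : 0 ≤ C)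
    (hD : 0 ≤ D) (hT : ∀ x, ‖T x‖ ≤ C * ‖x‖) (hT' : ∀ x, ‖x‖ ≤ D * ‖T x‖) :
    banachMazurDist ℂ X Y ≤ C * D := by
  have hinj : Function.Injective T := by
    rw [injective_iff_map_eq_zero]
    intro x hx
    have := hT' x
    rwa [hx, norm_zero, mul_zero, norm_le_zero_iff] at this
  let e := (LinearEquiv.ofInjectiveOfFinrankEq T hinj hXY).toContinuousLinearEquiv
  have he (x) : e x = T x := rfl
  refine (ciInf_le ⟨0, ?_⟩ e).trans (mul_le_mul ?_ ?_ (norm_nonneg _) hC)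
  · rintro _ ⟨A, rfl⟩
    positivity
  · exact ContinuousLinearMap.opNorm_le_bound _ hC hT
  · refine ContinuousLinearMap.opNorm_le_bound _ hD fun y => ?_
    have := hT' (e.symm y)
    rwa [← he, e.apply_symm_apply] at this

end BanachMazur

lemma le_banachMazurDist_complexEll {p q : ℝ≥0∞} [Fact (1 ≤ p)] [Fact (1 ≤ q)] {n : ℕ} {C : ℝ}
    (h : ∀ A : ComplexEll p n ≃L[ℂ] ComplexEll q n,
      C ≤ ‖(A : ComplexEll p n →L[ℂ] ComplexEll q n)‖ *
        ‖(A.symm : ComplexEll q n →L[ℂ] ComplexEll p n)‖) :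
    C ≤ banachMazurDist ℂ (ComplexEll p n) (ComplexEll q n) :=
  haveI : Nonempty (ComplexEll p n ≃L[ℂ] ComplexEll q n) :=
    ⟨(PiLp.continuousLinearEquiv p ℂ _).trans (PiLp.continuousLinearEquiv q ℂ _).symm⟩
  le_ciInf h

/-- The linear map `x ↦ U x`, from `ℓ_p^n(ℂ)` to `ℓ_q^n(ℂ)`. -/
noncomputable def matrixLinearMap (p q : ℝ≥0∞) {n : ℕ} (U : Fin n → Fin n → ℂ) :
    ComplexEll p n →ₗ[ℂ] ComplexEll q n where
  toFun x := WithLp.toLp q fun i => ∑ j, x j * U i j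
  map_add' x y := by
    ext i
    simp [add_mul, Finset.sum_add_distrib]
  map_smul' c x := by
    ext i
    simp [Finset.mul_sum, mul_assoc]

@[simp] lemma matrixLinearMap_apply (p q : ℝ≥0∞) {n : ℕ} (U : Fin n → Fin n → ℂ)
    (x : ComplexEll p n) (i : Fin n) : matrixLinearMap p q U x i = ∑ j, x j * U i j := rfl

lemma finrank_complexEll (p : ℝ≥0∞) (n : ℕ) : Module.finrank ℂ (ComplexEll p n) = n := by
  rw [LinearEquiv.finrank_eq (WithLp.linearEquiv p ℂ (Fin n → ℂ)), Module.finrank_fin_fun]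

lemma norm_le_of_forall_apply_le {n : ℕ} {y : ComplexEll ∞ n} {C : ℝ} (hC : 0 ≤ C)
    (h : ∀ i, ‖y i‖ ≤ C) : ‖y‖ ≤ C := by
  rw [← PiLp.norm_ofLp]
  exact (pi_norm_le_iff_of_nonneg hC).2 h

/-- The upper bound is attained by the character table. -/
lemma banachMazurDist_one_top_le {n : ℕ} (hn : n = 2 ∨ n = 3) :
    banachMazurDist ℂ (ComplexEll 1 n) (ComplexEll ∞ n) ≤ √(n : ℝ) := by
  obtain ⟨U, hU, hUx⟩ := exists_flat_isometry hn
  have hn0 : (0 : ℝ) < n := by rcases hn with rfl | rfl <;> norm_num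
  rw [← one_mul √(n : ℝ)]
  refine banachMazurDist_le_of_bounds (by simp only [finrank_complexEll]) (matrixLinearMap 1 ∞ U)
    zero_le_one (Real.sqrt_nonneg _) (fun x => ?_) (fun x => ?_)
  · refine norm_le_of_forall_apply_le (by positivity) fun i => ?_
    rw [matrixLinearMap_apply, one_mul, PiLp.norm_eq_of_L1]
    refine (norm_sum_le _ _).trans_eq ?_
    simp [hU]
  · set y := matrixLinearMap 1 ∞ U x
    -- `∑ |x j|² ≤ ‖y‖²`, and the Cauchy–Schwarz inequality
    have h1 : n * ∑ j, ‖x j‖ ^ 2 ≤ n * ‖y‖ ^ 2 := by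
      have := hUx x.ofLp
      simp only [Complex.normSq_eq_norm_sq] at this
      rw [← this]
      calc _ ≤ ∑ _i : Fin n, ‖y‖ ^ 2 := by
            gcongr with i
            exact PiLp.norm_apply_le y i
        _ = n * ‖y‖ ^ 2 := by simp
    have h2 := le_of_mul_le_mul_left h1 hn0
    have h3 : (∑ j, ‖x j‖) ^ 2 ≤ n * ∑ j, ‖x j‖ ^ 2 := by
      simpa using sq_sum_le_card_mul_sum_sq (s := Finset.univ) (f := fun j => ‖x j‖)
    rw [PiLp.norm_eq_of_L1]
    refine le_of_sq_le_sq ?_ (by positivity)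
    rw [mul_pow, Real.sq_sqrt hn0.le]
    exact h3.trans (by gcongr)

lemma exists_isUnimodular_norm_stdInner_le {n : ℕ} (hn : n = 2 ∨ n = 3) (a : Fin n → (Fin n → ℂ))
    (ha : ∀ i, ‖a i‖ ≤ 1) :
    ∃ x : Fin n → ℂ, IsUnimodular x ∧ ∀ i, ‖stdInner x (a i)‖ ≤ √(n : ℝ) := by
  rcases hn with rfl | rfl
  · simpa using exists_isUnimodular_norm_stdInner_le_two a ha
  · simpa using exists_isUnimodular_norm_stdInner_le_three a ha

/-- A unimodular vector has norm `n` in `ℓ_1^n`. If it balances the rows of the matrix of `A`, its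
image has norm at most `‖A‖ √n`, which makes `‖A⁻¹‖` large. -/
lemma sqrt_le_banachMazurDist_one_top {n : ℕ} (hn : n = 2 ∨ n = 3) :
    √(n : ℝ) ≤ banachMazurDist ℂ (ComplexEll 1 n) (ComplexEll ∞ n) := by
  refine le_banachMazurDist_complexEll fun A => ?_
  set M := ‖(A : ComplexEll 1 n →L[ℂ] ComplexEll ∞ n)‖
  have hn0 : 0 < n := by omega
  have hn0' : (0 : ℝ) < n := by exact_mod_cast hn0
  have hsymm (x : ComplexEll 1 n) :
      ‖x‖ ≤ ‖(A.symm : ComplexEll ∞ n →L[ℂ] ComplexEll 1 n)‖ * ‖A x‖ := by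
    have := (A.symm : ComplexEll ∞ n →L[ℂ] ComplexEll 1 n).le_opNorm (A x)
    simpa using this
  have hM : 0 < M := by
    refine norm_pos_iff.2 fun h0 => ?_
    have h1 : A (PiLp.single 1 ⟨0, hn0⟩ 1) = 0 := by
      simpa only [ContinuousLinearEquiv.coe_coe, zero_apply] using
        congrArg (fun T : ComplexEll 1 n →L[ℂ] ComplexEll ∞ n => T (PiLp.single 1 ⟨0, hn0⟩ 1)) h0
    have h2 := hsymm (PiLp.single 1 ⟨0, hn0⟩ 1)
    rw [h1, norm_zero, mul_zero, PiLp.norm_single] at h2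
    norm_num at h2
  -- the rows of the matrix of `A`, divided by `M`, lie in the unit ball of the maximum norm
  have hent (i j) : ‖A (PiLp.single 1 j 1) i‖ ≤ M := by
    refine (PiLp.norm_apply_le _ i).trans ?_
    have := (A : ComplexEll 1 n →L[ℂ] ComplexEll ∞ n).le_opNorm (PiLp.single 1 j 1)
    rwa [PiLp.norm_single, norm_one, mul_one] at this
  obtain ⟨x, hx, hxa⟩ := exists_isUnimodular_norm_stdInner_le hn
    (fun i j => (starRingEnd ℂ) (A (PiLp.single 1 j 1) i) / M) (fun i => by
      refine (pi_norm_le_iff_of_nonneg zero_le_one).2 fun j => ?_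
      rw [norm_div, Complex.norm_conj, Complex.norm_of_nonneg hM.le]
      exact (div_le_one hM).2 (hent i j))
  have hAx (i) : A (WithLp.toLp 1 x) i = ∑ j, x j * A (PiLp.single 1 j 1) i := by
    have : WithLp.toLp 1 x = ∑ j, x j • (PiLp.single 1 j 1 : ComplexEll 1 n) := by
      ext i
      simp [Pi.single_apply]
    rw [this, map_sum]
    simp
  have h1 : ‖A (WithLp.toLp 1 x)‖ ≤ M * √(n : ℝ) := by
    refine norm_le_of_forall_apply_le (by positivity) fun i => ?_
    have h := hxa i
    have e : stdInner x (fun j => (starRingEnd ℂ) (A (PiLp.single 1 j 1) i) / M)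
        = A (WithLp.toLp 1 x) i / M := by
      rw [hAx, stdInner, Finset.sum_div]
      refine Finset.sum_congr rfl fun j _ => ?_
      rw [map_div₀, Complex.conj_conj, Complex.conj_ofReal, mul_div_assoc]
    rw [e, norm_div, Complex.norm_of_nonneg hM.le, div_le_iff₀ hM] at h
    linarith
  have h2 : (n : ℝ) ≤ ‖(A.symm : ComplexEll ∞ n →L[ℂ] ComplexEll 1 n)‖ * (M * √(n : ℝ)) := by
    have h := hsymm (WithLp.toLp 1 x)
    rw [PiLp.norm_eq_of_L1] at h
    simp only [hx _, Finset.sum_const, Finset.card_univ, Fintype.card_fin, nsmul_eq_mul,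
      mul_one] at h
    exact h.trans (by gcongr)
  refine le_of_mul_le_mul_right ?_ (Real.sqrt_pos.2 hn0')
  rw [Real.mul_self_sqrt hn0'.le]
  linarith

/-! ### The norm from `ℓ_∞^2` to `ℓ_1^2` and the determinant -/

/-- For unimodular `z`, the number `z⁻¹ (a + b z) (c + d z)` runs through an ellipse with centre
`a d + b c`, whose major semi-axis is `|a c| + |b d|`. One of the two ends of the major axis has
modulus at least `|a d - b c|`. -/
lemma exists_norm_det_le_mul (a b c d : ℂ) :
    ∃ z : ℂ, ‖z‖ = 1 ∧ ‖a * d - b * c‖ ≤ ‖a + b * z‖ * ‖c + d * z‖ := by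
  obtain ⟨τ₁, h₁, e₁⟩ := exists_norm_eq_one_mul_eq_norm (a * c)
  obtain ⟨τ₂, h₂, e₂⟩ := exists_norm_eq_one_mul_eq_norm (b * d)
  obtain ⟨z, hz⟩ := IsAlgClosed.exists_pow_nat_eq (τ₂ * (starRingEnd ℂ) τ₁) (n := 2) (by norm_num)
  have hz1 : ‖z‖ = 1 := by
    have : ‖z‖ ^ 2 = 1 := by rw [← norm_pow, hz, norm_mul, Complex.norm_conj, h₁, h₂, one_mul]
    exact (pow_eq_one_iff_of_nonneg (norm_nonneg _) (by norm_num)).1 this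
  have hτ₁ : (starRingEnd ℂ) τ₁ * τ₁ = 1 := by rw [Complex.conj_mul', h₁]; norm_num
  have hzz : (starRingEnd ℂ) z * z = 1 := by rw [Complex.conj_mul', hz1]; norm_num
  set v := a * c * (starRingEnd ℂ) z + b * d * z
  set s := a * d + b * c
  have hv : ‖v‖ = ‖a * c‖ + ‖b * d‖ := by
    have : τ₁ * z * v = ((‖a * c‖ + ‖b * d‖ : ℝ) : ℂ) := by
      push_cast
      rw [← e₁, ← e₂]
      linear_combination τ₁ * (a * c) * hzz + τ₁ * (b * d) * hz + τ₂ * (b * d) * hτ₁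
    have h := congrArg norm this
    rwa [norm_mul, norm_mul, h₁, hz1, one_mul, one_mul, Complex.norm_of_nonneg (by positivity)] at h
  have hprod : ‖a + b * z‖ * ‖c + d * z‖ = ‖s + v‖ := by
    rw [← norm_mul, show (a + b * z) * (c + d * z) = z * (s + v) by
      linear_combination -(a * c) * hzz, norm_mul, hz1, one_mul]
  have hprod' : ‖a + b * -z‖ * ‖c + d * -z‖ = ‖s - v‖ := by
    rw [← norm_mul, show (a + b * -z) * (c + d * -z) = -z * (s - v) by
      linear_combination -(a * c) * hzz, norm_mul, norm_neg, hz1, one_mul]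
  have hpar := parallelogram_law_with_norm ℂ s v
  have hdet : ‖a * d - b * c‖ ^ 2 ≤ ‖s‖ ^ 2 + ‖v‖ ^ 2 := by
    rw [← norm_pow, show (a * d - b * c) ^ 2 = s ^ 2 - 4 * ((a * c) * (b * d)) by ring, hv]
    refine (norm_sub_le _ _).trans ?_
    rw [norm_pow, norm_mul, norm_mul (a * c)]
    norm_num
    nlinarith [sq_nonneg (‖a‖ * ‖c‖ - ‖b‖ * ‖d‖)]
  rcases le_total ‖s - v‖ ‖s + v‖ with h | h
  · refine ⟨z, hz1, ?_⟩
    rw [hprod]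
    refine le_of_sq_le_sq ?_ (norm_nonneg _)
    nlinarith [norm_nonneg (s - v)]
  · refine ⟨-z, by rw [norm_neg, hz1], ?_⟩
    rw [hprod']
    refine le_of_sq_le_sq ?_ (norm_nonneg _)
    nlinarith [norm_nonneg (s + v)]

/-- This follows from `exists_norm_det_le_mul` by the inequality of the means. -/
lemma exists_two_mul_sqrt_norm_det_le_add (a b c d : ℂ) :
    ∃ z : ℂ, ‖z‖ = 1 ∧ 2 * √‖a * d - b * c‖ ≤ ‖a + b * z‖ + ‖c + d * z‖ := by
  obtain ⟨z, hz, h⟩ := exists_norm_det_le_mul a b c d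
  refine ⟨z, hz, ?_⟩
  refine le_of_sq_le_sq ?_ (by positivity)
  rw [mul_pow, Real.sq_sqrt (norm_nonneg _)]
  nlinarith [sq_nonneg (‖a + b * z‖ - ‖c + d * z‖)]

lemma two_mul_sqrt_norm_det_le_matrixOpNorm (A : Matrix (Fin 2) (Fin 2) ℂ) :
    2 * √‖A.det‖ ≤ matrixOpNorm ∞ 1 A := by
  obtain ⟨z, hz, h⟩ := exists_two_mul_sqrt_norm_det_le_add (A 0 0) (A 0 1) (A 1 0) (A 1 1)
  rw [Matrix.det_fin_two]
  refine h.trans ?_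
  have hx : ‖(WithLp.toLp ∞ ![1, z] : ComplexEll ∞ 2)‖ ≤ 1 :=
    norm_le_of_forall_apply_le zero_le_one fun i => by fin_cases i <;> simp [hz]
  have h1 := (LinearMap.toContinuousLinearMap
    (Matrix.toLpLin ∞ 1 A : ComplexEll ∞ 2 →ₗ[ℂ] ComplexEll 1 2)).unit_le_opNorm _ hx
  rw [LinearMap.coe_toContinuousLinearMap', Matrix.toLpLin_toLp, PiLp.norm_eq_of_L1] at h1
  simpa [Fin.sum_univ_two, Matrix.mulVec, dotProduct, matrixOpNorm] using h1

/-! ### Interpolation for the Hadamard matrix -/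

/-- The power `|w|^s`, with the phase of `w`, as an entire function of the exponent `s`. -/
noncomputable def phasedPower (w s : ℂ) : ℂ := w * Complex.exp (Real.log ‖w‖ * (s - 1))

lemma phasedPower_one (w : ℂ) : phasedPower w 1 = w := by simp [phasedPower]

lemma norm_phasedPower (w s : ℂ) (hs : s.re ≠ 0) : ‖phasedPower w s‖ = ‖w‖ ^ s.re := by
  rcases eq_or_ne w 0 with rfl | hw
  · simp [phasedPower, Real.zero_rpow hs]
  · have hw' : 0 < ‖w‖ := norm_pos_iff.2 hw
    rw [phasedPower, norm_mul, Complex.norm_exp, Complex.re_ofReal_mul, Complex.sub_re,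
      Complex.one_re, Real.rpow_def_of_pos hw', mul_sub, mul_one, Real.exp_sub, Real.exp_log hw']
    field_simp

lemma differentiable_phasedPower (w : ℂ) : Differentiable ℂ (phasedPower w) := by
  unfold phasedPower
  fun_prop

/-- The bilinear form of the matrix with rows `(1, 1)` and `(1, -1)` on the unit sphere of `ℓ_r^2`,
for `1 ≤ r ≤ 2`. This is interpolated, by the three lines theorem, between the trivial case
`r = 1` and the Cauchy–Schwarz inequality for `r = 2`. -/
lemma norm_hadamard_bilin_le {r : ℝ} (h1 : 1 ≤ r) (h2 : r ≤ 2) {x₁ x₂ y₁ y₂ : ℂ}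
    (hx : ‖x₁‖ ^ r + ‖x₂‖ ^ r ≤ 1) (hy : ‖y₁‖ ^ r + ‖y₂‖ ^ r ≤ 1) :
    ‖y₁ * (x₁ + x₂) + y₂ * (x₁ - x₂)‖ ≤ 2 ^ (1 - 1 / r) := by
  have hr0 : 0 < r := by linarith
  let s : ℂ → ℂ := fun z => r * (1 - z / 2)
  have hsre (z : ℂ) : (s z).re = r * (1 - z.re / 2) := by
    simp [s]
  let F : ℂ → ℂ := fun z =>
    phasedPower y₁ (s z) * (phasedPower x₁ (s z) + phasedPower x₂ (s z)) +
      phasedPower y₂ (s z) * (phasedPower x₁ (s z) - phasedPower x₂ (s z))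
  have hs : Differentiable ℂ s := by fun_prop
  have hF : Differentiable ℂ F := by
    have h (w : ℂ) : Differentiable ℂ fun z => phasedPower w (s z) :=
      (differentiable_phasedPower w).comp hs
    exact ((h y₁).mul ((h x₁).add (h x₂))).add ((h y₂).mul ((h x₁).sub (h x₂)))
  have hFle (z : ℂ) : ‖F z‖ ≤ (‖phasedPower y₁ (s z)‖ + ‖phasedPower y₂ (s z)‖) *
      (‖phasedPower x₁ (s z)‖ + ‖phasedPower x₂ (s z)‖) := by
    refine (norm_add_le _ _).trans ?_
    rw [norm_mul, norm_mul, add_mul]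
    gcongr
    · exact norm_add_le _ _
    · exact norm_sub_le _ _
  have hle1 {w w' : ℂ} (h : ‖w‖ ^ r + ‖w'‖ ^ r ≤ 1) : ‖w‖ ≤ 1 := by
    have : ‖w‖ ^ r ≤ 1 := by linarith [Real.rpow_nonneg (norm_nonneg w') r]
    by_contra! hc
    exact absurd (Real.one_lt_rpow hc hr0) this.not_gt
  have hx₁ := hle1 hx
  have hx₂ := hle1 (by rwa [add_comm] : ‖x₂‖ ^ r + ‖x₁‖ ^ r ≤ 1)
  have hy₁ := hle1 hy
  have hy₂ := hle1 (by rwa [add_comm] : ‖y₂‖ ^ r + ‖y₁‖ ^ r ≤ 1)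
  have hθ0 : 0 ≤ 2 * (1 - 1 / r) := by
    have : 1 / r ≤ 1 := by rw [div_le_one hr0]; exact h1
    linarith
  have hθ1 : 2 * (1 - 1 / r) ≤ 1 := by
    have : 1 / 2 ≤ 1 / r := one_div_le_one_div_of_le hr0 h2
    linarith
  have key := Complex.HadamardThreeLines.norm_le_interp_of_mem_verticalClosedStrip₀₁' F
    (z := ((2 * (1 - 1 / r) : ℝ) : ℂ)) (a := 1) (b := √2) ?_ hF.diffContOnCl ?_ ?_ ?_
  · have hs1 : s ((2 * (1 - 1 / r) : ℝ) : ℂ) = 1 := by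
      have : (r : ℂ) ≠ 0 := by exact_mod_cast hr0.ne'
      simp only [s]
      push_cast
      field_simp
      ring
    simp only [F, hs1, phasedPower_one, Complex.ofReal_re, Real.one_rpow, one_mul] at key
    rwa [Real.sqrt_eq_rpow, ← Real.rpow_mul (by norm_num), ← mul_assoc,
      show (1 / 2 : ℝ) * 2 = 1 by norm_num, one_mul] at key
  · rw [Complex.HadamardThreeLines.verticalClosedStrip, Set.mem_preimage, Complex.ofReal_re]
    exact ⟨hθ0, hθ1⟩
  · refine ⟨4, ?_⟩
    rintro _ ⟨z, hz, rfl⟩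
    simp only [Complex.HadamardThreeLines.verticalClosedStrip, Set.mem_preimage,
      Set.mem_Icc] at hz
    have hpos : 0 < (s z).re := by rw [hsre]; exact mul_pos hr0 (by linarith)
    have hb {w : ℂ} (hw : ‖w‖ ≤ 1) : ‖phasedPower w (s z)‖ ≤ 1 := by
      rw [norm_phasedPower _ _ hpos.ne']
      exact Real.rpow_le_one (norm_nonneg _) hw hpos.le
    refine (hFle z).trans ?_
    calc _ ≤ (1 + 1) * (1 + 1 : ℝ) := by
          gcongr
          exacts [hb hy₁, hb hy₂, hb hx₁, hb hx₂]
      _ = 4 := by norm_num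
  · intro z hz
    have hre : (s z).re = r := by rw [hsre, show z.re = 0 from hz]; ring
    have hn (w : ℂ) : ‖phasedPower w (s z)‖ = ‖w‖ ^ r := by
      rw [norm_phasedPower _ _ (by rw [hre]; exact hr0.ne'), hre]
    refine (hFle z).trans ?_
    rw [hn, hn, hn, hn]
    exact mul_le_one₀ hy (by positivity) hx
  · intro z hz
    have hre : (s z).re = r / 2 := by rw [hsre, show z.re = 1 from hz]; ring
    have hn (w : ℂ) : ‖phasedPower w (s z)‖ ^ 2 = ‖w‖ ^ r := by
      rw [norm_phasedPower _ _ (by rw [hre]; positivity), hre, ← Real.rpow_natCast,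
        ← Real.rpow_mul (norm_nonneg _)]
      congr 1
      push_cast
      ring
    have hx' := hx
    have hy' := hy
    rw [← hn, ← hn] at hx' hy'
    simp only [F]
    generalize phasedPower x₁ (s z) = u₁ at *
    generalize phasedPower x₂ (s z) = u₂ at *
    generalize phasedPower y₁ (s z) = v₁ at *
    generalize phasedPower y₂ (s z) = v₂ at *
    have hpar := parallelogram_law_with_norm ℂ u₁ u₂
    apply Real.le_sqrt_of_sq_le
    calc _ ≤ (‖v₁‖ * ‖u₁ + u₂‖ + ‖v₂‖ * ‖u₁ - u₂‖) ^ 2 := by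
          gcongr
          refine (norm_add_le _ _).trans_eq ?_
          rw [norm_mul, norm_mul]
      _ ≤ (‖v₁‖ ^ 2 + ‖v₂‖ ^ 2) * (‖u₁ + u₂‖ ^ 2 + ‖u₁ - u₂‖ ^ 2) := by
          nlinarith [sq_nonneg (‖v₁‖ * ‖u₁ - u₂‖ - ‖v₂‖ * ‖u₁ + u₂‖)]
      _ ≤ 1 * 2 := by
          gcongr
          nlinarith
      _ = 2 := one_mul 2

/-! ### Comparison of the norms of `ℓ_p^n` -/

lemma norm_complexEll_rpow {p : ℝ≥0∞} [Fact (1 ≤ p)] (hp : p ≠ ∞) {n : ℕ} (x : ComplexEll p n) :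
    ‖x‖ ^ p.toReal = ∑ i, ‖x i‖ ^ p.toReal := by
  have hp0 : 0 < p.toReal := ENNReal.toReal_pos (zero_lt_one.trans_le Fact.out).ne' hp
  rw [PiLp.norm_eq_sum hp0, ← Real.rpow_mul (by positivity), one_div, inv_mul_cancel₀ hp0.ne',
    Real.rpow_one]

/-- The norm of `ℓ_p^n` decreases with `p`. -/
lemma norm_toLp_le_norm_toLp {p q : ℝ≥0∞} [Fact (1 ≤ p)] [Fact (1 ≤ q)] (hpq : p ≤ q) {n : ℕ}
    (x : Fin n → ℂ) :
    ‖(WithLp.toLp q x : ComplexEll q n)‖ ≤ ‖(WithLp.toLp p x : ComplexEll p n)‖ := by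
  have hle (i) : ‖x i‖ ≤ ‖(WithLp.toLp p x : ComplexEll p n)‖ :=
    PiLp.norm_apply_le (WithLp.toLp p x : ComplexEll p n) i
  rcases eq_or_ne q ∞ with rfl | hq
  · exact norm_le_of_forall_apply_le (norm_nonneg _) hle
  · have hp : p ≠ ∞ := ne_top_of_le_ne_top hq hpq
    have hp0 : 0 < p.toReal := ENNReal.toReal_pos (zero_lt_one.trans_le Fact.out).ne' hp
    have hPQ : p.toReal ≤ q.toReal := ENNReal.toReal_mono hq hpq
    have hx := norm_complexEll_rpow hp (WithLp.toLp p x : ComplexEll p n)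
    set N := ‖(WithLp.toLp p x : ComplexEll p n)‖
    have hN : 0 ≤ N := norm_nonneg _
    refine (Real.rpow_le_rpow_iff (norm_nonneg _) hN (hp0.trans_le hPQ)).1 ?_
    rw [norm_complexEll_rpow hq]
    have hsplit {t : ℝ} (ht : 0 ≤ t) :
        t ^ q.toReal = t ^ p.toReal * t ^ (q.toReal - p.toReal) := by
      rw [← Real.rpow_add_of_nonneg ht hp0.le (by linarith), add_sub_cancel]
    rw [hsplit hN, hx, Finset.sum_mul]
    gcongr with i
    change ‖x i‖ ^ q.toReal ≤ ‖x i‖ ^ p.toReal * _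
    rw [hsplit (norm_nonneg _)]
    gcongr
    exact hle i

/-- Hölder's inequality between the norms of `ℓ_p^n` and `ℓ_q^n` for `p ≤ q`. -/
lemma norm_toLp_le_card_rpow_mul {p q : ℝ≥0∞} [Fact (1 ≤ p)] [Fact (1 ≤ q)] (hpq : p ≤ q) {n : ℕ}
    (x : Fin n → ℂ) : ‖(WithLp.toLp p x : ComplexEll p n)‖ ≤
      (n : ℝ) ^ ((1 / p).toReal - (1 / q).toReal) * ‖(WithLp.toLp q x : ComplexEll q n)‖ := by
  rcases eq_or_ne p ∞ with rfl | hp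
  · obtain rfl : q = ∞ := top_le_iff.1 hpq
    simp
  have hp0 : 0 < p.toReal := ENNReal.toReal_pos (zero_lt_one.trans_le Fact.out).ne' hp
  have hn : (0 : ℝ) ≤ n := by positivity
  refine (Real.rpow_le_rpow_iff (norm_nonneg _) (by positivity) hp0).1 ?_
  rw [norm_complexEll_rpow hp, Real.mul_rpow (by positivity) (norm_nonneg _), ← Real.rpow_mul hn]
  simp only [one_div, ENNReal.toReal_inv]
  rcases eq_or_ne q ∞ with rfl | hq
  · rw [ENNReal.toReal_top, inv_zero, sub_zero, inv_mul_cancel₀ hp0.ne', Real.rpow_one]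
    calc ∑ i, ‖x i‖ ^ p.toReal
        ≤ ∑ _i : Fin n, ‖(WithLp.toLp ∞ x : ComplexEll ∞ n)‖ ^ p.toReal := by
          gcongr with i
          exact PiLp.norm_apply_le (WithLp.toLp ∞ x : ComplexEll ∞ n) i
      _ = _ := by simp
  · have hPQ : p.toReal ≤ q.toReal := ENNReal.toReal_mono hq hpq
    have hq0 := hp0.trans_le hPQ
    rcases Nat.eq_zero_or_pos n with rfl | hnpos
    · simp only [Finset.univ_eq_empty, Finset.sum_empty]
      positivity
    have hn' : (0 : ℝ) < n := by exact_mod_cast hnpos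
    -- the power mean inequality with the exponent `q / p`
    have hmean := Real.arith_mean_le_rpow_mean Finset.univ (fun _ : Fin n => (1 / n : ℝ))
      (fun i => ‖x i‖ ^ p.toReal) (fun _ _ => by positivity) (by simp [hn'.ne'])
      (fun _ _ => by positivity) ((one_le_div hp0).2 hPQ)
    simp only [← Finset.mul_sum, ← Real.rpow_mul (norm_nonneg _),
      mul_div_cancel₀ _ hp0.ne'] at hmean
    have hx := norm_complexEll_rpow hq (WithLp.toLp q x : ComplexEll q n)
    simp only at hx
    rw [← hx, Real.mul_rpow (by positivity) (by positivity), ← Real.rpow_mul (norm_nonneg _),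
      one_div_div, mul_div_cancel₀ _ hq0.ne', one_div, inv_mul_le_iff₀ hn', ← mul_assoc] at hmean
    refine hmean.trans_eq ?_
    congr 1
    rw [Real.inv_rpow hn, ← Real.rpow_neg hn]
    nth_rewrite 1 [← Real.rpow_one (n : ℝ)]
    rw [← Real.rpow_add hn']
    congr 1
    field_simp
    ring

/-! ### The Hausdorff–Young inequality for `ℤ/2` -/

/-- The Hadamard matrix of order two. -/
noncomputable def hadamardTwo : Fin 2 → Fin 2 → ℂ := ![![1, 1], ![1, -1]]

lemma matrixLinearMap_hadamardTwo_zero (p q : ℝ≥0∞) (x : ComplexEll p 2) :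
    matrixLinearMap p q hadamardTwo x 0 = x 0 + x 1 := by
  simp [hadamardTwo, Fin.sum_univ_two]

lemma matrixLinearMap_hadamardTwo_one (p q : ℝ≥0∞) (x : ComplexEll p 2) :
    matrixLinearMap p q hadamardTwo x 1 = x 0 - x 1 := by
  simp [hadamardTwo, Fin.sum_univ_two, sub_eq_add_neg]

/-- The Hausdorff–Young inequality for the group `ℤ/2`, which is one of Clarkson's inequalities. -/
lemma norm_hadamardTwo_le {p r : ℝ≥0∞} [Fact (1 ≤ p)] [Fact (1 ≤ r)] (h : p⁻¹ + r⁻¹ = 1)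
    (hr : r ≤ 2) (x : ComplexEll r 2) :
    ‖matrixLinearMap r p hadamardTwo x‖ ≤ 2 ^ (1 / p).toReal * ‖x‖ := by
  rcases eq_or_ne p ∞ with rfl | hp
  · obtain rfl : r = 1 := by simpa using h
    simp only [one_div, ENNReal.inv_top, ENNReal.toReal_zero, Real.rpow_zero, one_mul]
    refine norm_le_of_forall_apply_le (norm_nonneg _) fun i => ?_
    rw [PiLp.norm_eq_of_L1, Fin.sum_univ_two]
    fin_cases i
    · exact (congrArg norm (matrixLinearMap_hadamardTwo_zero 1 ∞ x)).trans_le (norm_add_le _ _)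
    · exact (congrArg norm (matrixLinearMap_hadamardTwo_one 1 ∞ x)).trans_le (norm_sub_le _ _)
  have hr' : r ≠ ∞ := ne_top_of_le_ne_top ENNReal.ofNat_ne_top hr
  have hr1 : 1 ≤ r.toReal := by
    simpa using ENNReal.toReal_mono hr' (Fact.out : 1 ≤ r)
  have hr2 : r.toReal ≤ 2 := by simpa using ENNReal.toReal_mono ENNReal.ofNat_ne_top hr
  have hr0 : 0 < r.toReal := by linarith
  have : ENNReal.HolderConjugate p r := ENNReal.holderConjugate_iff.2 h
  have hconj : p.toReal.HolderConjugate r.toReal := ENNReal.HolderConjugate.toReal_of_ne_top hp hr'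
  rcases eq_or_ne x 0 with rfl | hx0
  · simp
  set N := ‖x‖
  have hN : 0 < N := norm_pos_iff.2 hx0
  have hNr : N ^ r.toReal = ‖x 0‖ ^ r.toReal + ‖x 1‖ ^ r.toReal := by
    rw [← Fin.sum_univ_two (fun i => ‖x i‖ ^ r.toReal), norm_complexEll_rpow hr']
  set u := matrixLinearMap r p hadamardTwo x
  have hu0 : u 0 = x 0 + x 1 := matrixLinearMap_hadamardTwo_zero r p x
  have hu1 : u 1 = x 0 - x 1 := matrixLinearMap_hadamardTwo_one r p x
  -- the norm of `u` is attained by a functional in the unit ball of `ℓ_r`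
  obtain ⟨g, hg, hgu⟩ := (NNReal.isGreatest_Lp (s := Finset.univ) (fun i => ‖u i‖₊) hconj).1
  have hg' : (g 0 : ℝ) ^ r.toReal + (g 1 : ℝ) ^ r.toReal ≤ 1 := by
    have : g 0 ^ r.toReal + g 1 ^ r.toReal ≤ 1 := by simpa [Fin.sum_univ_two] using hg
    exact_mod_cast this
  have hgu' : ‖u 0‖ * g 0 + ‖u 1‖ * g 1 = ‖u‖ := by
    rw [PiLp.norm_eq_sum (zero_lt_one.trans hconj.lt)]
    have := congrArg NNReal.toReal hgu
    push_cast at this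
    simpa [Fin.sum_univ_two] using this
  obtain ⟨τ₀, h₀, e₀⟩ := exists_norm_eq_one_mul_eq_norm (u 0)
  obtain ⟨τ₁, h₁, e₁⟩ := exists_norm_eq_one_mul_eq_norm (u 1)
  have key := norm_hadamard_bilin_le hr1 hr2 (x₁ := x 0 / N) (x₂ := x 1 / N) (y₁ := τ₀ * g 0)
    (y₂ := τ₁ * g 1) ?_ ?_
  · have e : τ₀ * g 0 * (x 0 / N + x 1 / N) + τ₁ * g 1 * (x 0 / N - x 1 / N)
        = ((‖u‖ / N : ℝ) : ℂ) := by
      rw [← add_div, ← sub_div, ← hu0, ← hu1, ← hgu']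
      push_cast
      rw [← e₀, ← e₁]
      ring
    rw [e, Complex.norm_of_nonneg (by positivity), div_le_iff₀ hN] at key
    have hexp : (1 / p).toReal = 1 - 1 / r.toReal := by
      rw [one_div, ENNReal.toReal_inv, one_div]
      linarith [hconj.inv_add_inv_eq_one]
    rwa [hexp]
  · rw [norm_div, norm_div, Complex.norm_of_nonneg hN.le, Real.div_rpow (norm_nonneg _) hN.le,
      Real.div_rpow (norm_nonneg _) hN.le, ← add_div, ← hNr, div_self (by positivity)]
  · rw [norm_mul, norm_mul, h₀, h₁, one_mul, one_mul]
    simpa using hg'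

/-! ### Determinants and lower bounds for operator norms -/

lemma ComplexEll.apply_eq {p q : ℝ≥0∞} [Fact (1 ≤ p)] [Fact (1 ≤ q)]
    (T : ComplexEll p 2 →L[ℂ] ComplexEll q 2) (x : ComplexEll p 2) (i : Fin 2) :
    T x i = x 0 * T (PiLp.single p 0 1) i + x 1 * T (PiLp.single p 1 1) i := by
  have : x = x 0 • (PiLp.single p 0 1 : ComplexEll p 2) + x 1 • PiLp.single p 1 1 := by
    ext i
    fin_cases i <;> simp
  conv_lhs => rw [this, map_add, map_smul, map_smul]
  simp

/-- The determinant of the matrix of an operator from `ℓ_p^2(ℂ)` to `ℓ_q^2(ℂ)`. -/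
noncomputable def detTwo {p q : ℝ≥0∞} [Fact (1 ≤ p)] [Fact (1 ≤ q)]
    (T : ComplexEll p 2 →L[ℂ] ComplexEll q 2) : ℂ :=
  T (PiLp.single p 0 1) 0 * T (PiLp.single p 1 1) 1 -
    T (PiLp.single p 1 1) 0 * T (PiLp.single p 0 1) 1

section LowerBounds

variable {p q : ℝ≥0∞} [Fact (1 ≤ p)] [Fact (1 ≤ q)]

lemma detTwo_mul_detTwo_symm (A : ComplexEll p 2 ≃L[ℂ] ComplexEll q 2) :
    detTwo (A : ComplexEll p 2 →L[ℂ] ComplexEll q 2) *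
      detTwo (A.symm : ComplexEll q 2 →L[ℂ] ComplexEll p 2) = 1 := by
  have h (j i : Fin 2) := ComplexEll.apply_eq (A : ComplexEll p 2 →L[ℂ] ComplexEll q 2)
    (A.symm (PiLp.single q j 1)) i
  have h00 := h 0 0
  have h01 := h 0 1
  have h10 := h 1 0
  have h11 := h 1 1
  simp at h00 h01 h10 h11
  simp only [detTwo, ContinuousLinearEquiv.coe_coe]
  set a := fun i j => A (PiLp.single p j 1) i with ha
  set b := fun i j => A.symm (PiLp.single q j 1) i with hb
  change (a 0 0 * a 1 1 - a 0 1 * a 1 0) * (b 0 0 * b 1 1 - b 0 1 * b 1 0) = 1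
  change 1 = b 0 0 * a 0 0 + b 1 0 * a 0 1 at h00
  change 0 = b 0 0 * a 1 0 + b 1 0 * a 1 1 at h01
  change 0 = b 0 1 * a 0 0 + b 1 1 * a 0 1 at h10
  change 1 = b 0 1 * a 1 0 + b 1 1 * a 1 1 at h11
  linear_combination -(b 0 1 * a 1 0 + b 1 1 * a 1 1) * h00 - h11
    + (b 0 1 * a 0 0 + b 1 1 * a 0 1) * h01

/-- The bound `2 √|det T| ≤ ‖T‖_{∞ → 1}`, transferred to the other exponents by Hölder's
inequality. -/
lemma two_mul_sqrt_norm_detTwo_le (T : ComplexEll p 2 →L[ℂ] ComplexEll q 2) :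
    2 * √‖detTwo T‖ ≤ 2 ^ (1 - (1 / q).toReal + (1 / p).toReal) * ‖T‖ := by
  obtain ⟨z, hz, h⟩ := exists_two_mul_sqrt_norm_det_le_add (T (PiLp.single p 0 1) 0)
    (T (PiLp.single p 1 1) 0) (T (PiLp.single p 0 1) 1) (T (PiLp.single p 1 1) 1)
  have hx : ‖(WithLp.toLp p ![1, z] : ComplexEll p 2)‖ ≤ 2 ^ (1 / p).toReal := by
    have h1 : ‖(WithLp.toLp ∞ ![1, z] : ComplexEll ∞ 2)‖ ≤ 1 :=
      norm_le_of_forall_apply_le zero_le_one fun i => by fin_cases i <;> simp [hz]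
    have h2 := norm_toLp_le_card_rpow_mul (le_top : p ≤ ∞) ![1, z]
    simp only [one_div, ENNReal.inv_top, ENNReal.toReal_zero, sub_zero] at h2 ⊢
    exact h2.trans (mul_le_of_le_one_right (by positivity) h1)
  set y := T (WithLp.toLp p ![1, z])
  have hy : 2 * √‖detTwo T‖ ≤ ‖(WithLp.toLp 1 y.ofLp : ComplexEll 1 2)‖ := by
    rw [PiLp.norm_eq_of_L1, Fin.sum_univ_two]
    refine h.trans_eq ?_
    simp only [y, ComplexEll.apply_eq T (WithLp.toLp p ![1, z])]
    simp [mul_comm]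
  have hy2 := norm_toLp_le_card_rpow_mul (Fact.out : 1 ≤ q) y.ofLp
  simp only [one_div, inv_one, ENNReal.toReal_one, Nat.cast_ofNat, WithLp.toLp_ofLp] at hy2
  rw [Real.rpow_add two_pos]
  calc _ ≤ _ := hy
    _ ≤ 2 ^ (1 - (1 / q).toReal) * ‖y‖ := by rw [one_div]; exact hy2
    _ ≤ 2 ^ (1 - (1 / q).toReal) * (‖T‖ * 2 ^ (1 / p).toReal) := by
      gcongr
      exact (T.le_opNorm _).trans (by gcongr)
    _ = _ := by ring

lemma norm_two_sq (x : Fin 2 → ℂ) :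
    ‖(WithLp.toLp 2 x : ComplexEll 2 2)‖ ^ 2 = ‖x 0‖ ^ 2 + ‖x 1‖ ^ 2 := by
  rw [PiLp.norm_sq_eq_of_L2, Fin.sum_univ_two]

/-- Hadamard's determinant inequality, in dimension two. -/
lemma norm_det_le_mul_norm (x y : Fin 2 → ℂ) : ‖x 0 * y 1 - y 0 * x 1‖ ≤
    ‖(WithLp.toLp 2 x : ComplexEll 2 2)‖ * ‖(WithLp.toLp 2 y : ComplexEll 2 2)‖ := by
  refine le_of_sq_le_sq ?_ (by positivity)
  rw [mul_pow, norm_two_sq, norm_two_sq]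
  calc _ ≤ (‖x 0‖ * ‖y 1‖ + ‖y 0‖ * ‖x 1‖) ^ 2 := by
        gcongr
        refine (norm_sub_le _ _).trans_eq ?_
        rw [norm_mul, norm_mul]
    _ ≤ _ := by nlinarith [sq_nonneg (‖x 0‖ * ‖y 0‖ - ‖x 1‖ * ‖y 1‖)]

/-- Hadamard's inequality for the columns of `T`, the images of the unit vectors. -/
lemma sqrt_norm_detTwo_le_of_two_le (hp : 2 ≤ p) (T : ComplexEll q 2 →L[ℂ] ComplexEll p 2) :
    √‖detTwo T‖ ≤ 2 ^ (1 / 2 - (1 / p).toReal) * ‖T‖ := by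
  have hcol (j) : ‖(WithLp.toLp 2 (T (PiLp.single q j 1)).ofLp : ComplexEll 2 2)‖ ≤
      2 ^ (1 / 2 - (1 / p).toReal) * ‖T‖ := by
    have h1 := norm_toLp_le_card_rpow_mul hp (T (PiLp.single q j 1)).ofLp
    have h2 := T.le_opNorm (PiLp.single q j 1)
    rw [PiLp.norm_single, norm_one, mul_one] at h2
    simp only [one_div, ENNReal.toReal_inv, ENNReal.toReal_ofNat, Nat.cast_ofNat,
      WithLp.toLp_ofLp] at h1 ⊢
    exact h1.trans (by gcongr)
  refine Real.sqrt_le_iff.2 ⟨by positivity, ?_⟩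
  rw [pow_two]
  exact (norm_det_le_mul_norm _ _).trans (mul_le_mul (hcol 0) (hcol 1) (norm_nonneg _)
    (by positivity))

/-- Hadamard's inequality for the rows of `T`. -/
lemma sqrt_norm_detTwo_le_of_le_two (hq : q ≤ 2) (T : ComplexEll q 2 →L[ℂ] ComplexEll p 2) :
    √‖detTwo T‖ ≤ 2 ^ ((1 / q).toReal - 1 / 2) * ‖T‖ := by
  have hrow (i) : ‖(WithLp.toLp 2 (fun j => T (PiLp.single q j 1) i) : ComplexEll 2 2)‖ ≤
      2 ^ ((1 / q).toReal - 1 / 2) * ‖T‖ := by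
    -- test `T` on the conjugate of its `i`-th row
    set w : Fin 2 → ℂ := fun j => (starRingEnd ℂ) (T (PiLp.single q j 1) i)
    have hw : ‖(WithLp.toLp 2 (fun j => T (PiLp.single q j 1) i) : ComplexEll 2 2)‖
        = ‖(WithLp.toLp 2 w : ComplexEll 2 2)‖ := by
      rw [PiLp.norm_eq_of_L2, PiLp.norm_eq_of_L2]
      simp [w]
    rw [hw]
    rcases (norm_nonneg (WithLp.toLp 2 w : ComplexEll 2 2)).eq_or_lt with h0 | h0
    · rw [← h0]; positivity
    refine le_of_mul_le_mul_right ?_ h0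
    have h1 := norm_toLp_le_card_rpow_mul hq w
    simp only [one_div, ENNReal.toReal_inv, ENNReal.toReal_ofNat, Nat.cast_ofNat] at h1 ⊢
    calc ‖(WithLp.toLp 2 w : ComplexEll 2 2)‖ * ‖(WithLp.toLp 2 w : ComplexEll 2 2)‖
        = ‖T (WithLp.toLp q w) i‖ := by
          rw [← pow_two, norm_two_sq, ComplexEll.apply_eq]
          simp only [w, Complex.conj_mul', ← Complex.ofReal_pow, ← Complex.ofReal_add,
            Complex.norm_conj]
          rw [Complex.norm_of_nonneg (by positivity)]
      _ ≤ ‖T‖ * ‖(WithLp.toLp q w : ComplexEll q 2)‖ :=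
          (PiLp.norm_apply_le _ i).trans (T.le_opNorm _)
      _ ≤ ‖T‖ * (2 ^ (q.toReal⁻¹ - 2⁻¹) * ‖(WithLp.toLp 2 w : ComplexEll 2 2)‖) := by gcongr
      _ = _ := by ring
  refine Real.sqrt_le_iff.2 ⟨by positivity, ?_⟩
  rw [pow_two]
  refine le_trans (le_of_eq ?_) ((norm_det_le_mul_norm _ _).trans (mul_le_mul (hrow 0) (hrow 1)
    (norm_nonneg _) (by positivity)))
  rw [detTwo]
  congr 1
  ring

lemma rpow_max_le_banachMazurDist (hq : q ≤ 2) (hp : 2 ≤ p) :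
    (2 : ℝ) ^ max (1 / 2 - (1 / p).toReal) ((1 / q).toReal - 1 / 2) ≤
      banachMazurDist ℂ (ComplexEll p 2) (ComplexEll q 2) := by
  refine le_banachMazurDist_complexEll fun A => ?_
  have hdet : √‖detTwo (A : ComplexEll p 2 →L[ℂ] ComplexEll q 2)‖ *
      √‖detTwo (A.symm : ComplexEll q 2 →L[ℂ] ComplexEll p 2)‖ = 1 := by
    rw [← Real.sqrt_mul (norm_nonneg _), ← norm_mul, detTwo_mul_detTwo_symm, norm_one,
      Real.sqrt_one]
  have h₁ := two_mul_sqrt_norm_detTwo_le (A : ComplexEll p 2 →L[ℂ] ComplexEll q 2)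
  have h₂ := sqrt_norm_detTwo_le_of_two_le hp (A.symm : ComplexEll q 2 →L[ℂ] ComplexEll p 2)
  have h₃ := sqrt_norm_detTwo_le_of_le_two hq (A.symm : ComplexEll q 2 →L[ℂ] ComplexEll p 2)
  set M := ‖(A : ComplexEll p 2 →L[ℂ] ComplexEll q 2)‖
  set M' := ‖(A.symm : ComplexEll q 2 →L[ℂ] ComplexEll p 2)‖
  set d := √‖detTwo (A : ComplexEll p 2 →L[ℂ] ComplexEll q 2)‖
  set d' := √‖detTwo (A.symm : ComplexEll q 2 →L[ℂ] ComplexEll p 2)‖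
  have hd' : 0 ≤ d' := Real.sqrt_nonneg _
  -- multiply the lower bounds for the two norms
  have key {s t : ℝ} (h : d' ≤ 2 ^ s * M') (hst : 1 - (1 / q).toReal + (1 / p).toReal + s = 1 - t) :
      (2 : ℝ) ^ t ≤ M * M' := by
    have h4 := mul_le_mul h₁ h hd' (by positivity)
    have h5 : (2 : ℝ) ^ (1 - t) * 2 ^ t = 2 := by
      rw [← Real.rpow_add two_pos, sub_add_cancel, Real.rpow_one]
    have h6 : (2 : ℝ) ^ (1 - t) * 2 ^ t ≤ 2 ^ (1 - t) * (M * M') := by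
      rw [h5, ← hst, Real.rpow_add two_pos]
      linarith
    exact le_of_mul_le_mul_left h6 (by positivity)
  rcases max_choice (1 / 2 - (1 / p).toReal) ((1 / q).toReal - 1 / 2) with h | h <;> rw [h]
  · exact key h₃ (by ring)
  · exact key h₂ (by ring)

end LowerBounds

/-! ### The distance between `ℓ_p^2` and `ℓ_q^2` -/

section UpperBound

variable {p q : ℝ≥0∞}

lemma hadamardTwo_hadamardTwo (x : ComplexEll p 2) :
    matrixLinearMap q p hadamardTwo (matrixLinearMap p q hadamardTwo x) = (2 : ℂ) • x := by
  ext i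
  fin_cases i
  · refine (matrixLinearMap_hadamardTwo_zero q p _).trans ?_
    rw [matrixLinearMap_hadamardTwo_zero, matrixLinearMap_hadamardTwo_one]
    change _ = 2 * x 0
    ring
  · refine (matrixLinearMap_hadamardTwo_one q p _).trans ?_
    rw [matrixLinearMap_hadamardTwo_zero, matrixLinearMap_hadamardTwo_one]
    change _ = 2 * x 1
    ring

variable [Fact (1 ≤ p)] [Fact (1 ≤ q)]

/-- The bound for the Hadamard matrix, through the Euclidean norm. -/
lemma norm_hadamardTwo_le_of_le_two_of_two_le (hq : q ≤ 2) (hp : 2 ≤ p) (x : ComplexEll p 2) :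
    ‖matrixLinearMap p q hadamardTwo x‖ ≤
      2 ^ (1 / 2 + (1 / q).toReal - (1 / p).toReal) * ‖x‖ := by
  set y := matrixLinearMap p q hadamardTwo x
  have h1 := norm_toLp_le_card_rpow_mul hq y.ofLp
  have h2 : ‖(WithLp.toLp 2 y.ofLp : ComplexEll 2 2)‖
      ≤ 2 ^ (1 / 2 : ℝ) * ‖(WithLp.toLp 2 x.ofLp : ComplexEll 2 2)‖ :=
    (norm_hadamardTwo_le (p := 2) (by rw [ENNReal.inv_two_add_inv_two]) le_rfl
      (WithLp.toLp 2 x.ofLp)).trans_eq (by simp)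
  have h3 := norm_toLp_le_card_rpow_mul hp x.ofLp
  simp only [one_div, ENNReal.toReal_inv, ENNReal.toReal_ofNat, Nat.cast_ofNat,
    WithLp.toLp_ofLp] at h1 h2 h3 ⊢
  have e : (2 : ℝ) ^ (2⁻¹ + q.toReal⁻¹ - p.toReal⁻¹) =
      2 ^ (q.toReal⁻¹ - 2⁻¹) * (2 ^ (2⁻¹ : ℝ) * 2 ^ (2⁻¹ - p.toReal⁻¹)) := by
    rw [← Real.rpow_add two_pos, ← Real.rpow_add two_pos]
    congr 1
    ring
  rw [e, mul_assoc, mul_assoc]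
  exact h1.trans (mul_le_mul_of_nonneg_left (h2.trans (by gcongr)) (by positivity))

/-- The exponent conjugate to `r`. -/
lemma exists_conjugate_exponent (r : ℝ≥0∞) [Fact (1 ≤ r)] :
    ∃ s : ℝ≥0∞, 1 ≤ s ∧ r⁻¹ + s⁻¹ = 1 ∧ (1 / s).toReal = 1 - (1 / r).toReal := by
  have hr : r⁻¹ ≤ 1 := ENNReal.inv_le_one.2 Fact.out
  refine ⟨(1 - r⁻¹)⁻¹, ENNReal.one_le_inv.2 tsub_le_self, ?_, ?_⟩
  · rw [inv_inv, add_tsub_cancel_of_le hr]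
  · rw [one_div, one_div, inv_inv, ENNReal.toReal_sub_of_le hr ENNReal.one_ne_top,
      ENNReal.toReal_one]

lemma le_of_toReal_one_div_le {r s : ℝ≥0∞} [Fact (1 ≤ r)] [Fact (1 ≤ s)]
    (h : (1 / r).toReal ≤ (1 / s).toReal) : s ≤ r := by
  have hf (t : ℝ≥0∞) [Fact (1 ≤ t)] : 1 / t ≠ ∞ := by
    rw [one_div]
    exact ENNReal.inv_ne_top.2 (zero_lt_one.trans_le Fact.out).ne'
  rw [ENNReal.toReal_le_toReal (hf r) (hf s), one_div, one_div] at h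
  exact ENNReal.inv_le_inv.1 h

/-- The Hausdorff–Young inequality for exponents that need not be conjugate: one of them is replaced
by the conjugate of the other, which does not increase the norm on the source or decrease the norm
on the target. -/
lemma norm_hadamardTwo_le_rpow_max (hq : q ≤ 2) (hp : 2 ≤ p) (y : ComplexEll q 2) :
    ‖matrixLinearMap q p hadamardTwo y‖ ≤ 2 ^ max (1 - (1 / q).toReal) (1 / p).toReal * ‖y‖ := by
  rcases le_total (1 / p).toReal (1 - (1 / q).toReal) with h | h
  · obtain ⟨r, hr1, hr, hr'⟩ := exists_conjugate_exponent q
    have : Fact (1 ≤ r) := ⟨hr1⟩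
    rw [max_eq_left h, ← hr']
    rw [← hr'] at h
    exact (norm_toLp_le_norm_toLp (le_of_toReal_one_div_le h) _).trans
      (norm_hadamardTwo_le (p := r) (by rw [add_comm, hr]) hq y)
  · obtain ⟨s, hs1, hs, hs'⟩ := exists_conjugate_exponent p
    have : Fact (1 ≤ s) := ⟨hs1⟩
    have hs2 : s ≤ 2 := by
      refine le_of_toReal_one_div_le ?_
      rw [hs']
      have : (1 / p).toReal ≤ (1 / 2 : ℝ≥0∞).toReal :=
        ENNReal.toReal_mono (by simp) (by gcongr)
      simp only [one_div, ENNReal.toReal_inv, ENNReal.toReal_ofNat] at this ⊢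
      linarith
    have hqs : q ≤ s := le_of_toReal_one_div_le (by linarith)
    rw [max_eq_right h]
    refine (norm_hadamardTwo_le (p := p) hs hs2 (WithLp.toLp s y.ofLp)).trans ?_
    gcongr
    exact norm_toLp_le_norm_toLp hqs y.ofLp

lemma banachMazurDist_le_rpow_max (hq : q ≤ 2) (hp : 2 ≤ p) :
    banachMazurDist ℂ (ComplexEll p 2) (ComplexEll q 2) ≤
      (2 : ℝ) ^ max (1 / 2 - (1 / p).toReal) ((1 / q).toReal - 1 / 2) := by
  refine (banachMazurDist_le_of_bounds (by simp only [finrank_complexEll])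
    (matrixLinearMap p q hadamardTwo) (C := 2 ^ (1 / 2 + (1 / q).toReal - (1 / p).toReal))
    (D := 2 ^ (max (1 - (1 / q).toReal) (1 / p).toReal - 1)) (by positivity) (by positivity)
    (norm_hadamardTwo_le_of_le_two_of_two_le hq hp) fun x => ?_).trans_eq ?_
  · have h := norm_hadamardTwo_le_rpow_max hq hp (matrixLinearMap p q hadamardTwo x)
    rw [hadamardTwo_hadamardTwo, norm_smul, Complex.norm_ofNat] at h
    rw [Real.rpow_sub_one two_ne_zero]
    linarith
  · rw [← Real.rpow_add two_pos]
    congr 1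
    rw [← add_sub_assoc, ← max_add_add_left, ← max_sub_sub_right]
    congr 1 <;> ring

end UpperBound

/-- In the first two parts `‖a i‖` is the maximum norm, which is the norm of `Fin n → ℂ`. -/
theorem mainTheorem1 :
    -- every family in the unit ball of the maximum norm is balanced within `√n`
    (∀ n : ℕ, n = 2 ∨ n = 3 → ∀ a : Fin n → (Fin n → ℂ), (∀ i, ‖a i‖ ≤ 1) →
      ∃ x : Fin n → ℂ, IsUnimodular x ∧ ∀ i, ‖stdInner x (a i)‖ ≤ √(n : ℝ)) ∧
    -- and `√n` cannot be replaced by a smaller constant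
    (∀ n : ℕ, n = 2 ∨ n = 3 → ∃ a : Fin n → (Fin n → ℂ), (∀ i, ‖a i‖ ≤ 1) ∧
      ∀ x : Fin n → ℂ, IsUnimodular x → ∃ i, √(n : ℝ) ≤ ‖stdInner x (a i)‖) ∧
    (∀ n : ℕ, n = 2 ∨ n = 3 →
      banachMazurDist ℂ (ComplexEll 1 n) (ComplexEll ∞ n) = √(n : ℝ)) ∧
    (∀ (p q : ℝ≥0∞) [Fact (1 ≤ p)] [Fact (1 ≤ q)], q ≤ 2 → 2 ≤ p →
      banachMazurDist ℂ (ComplexEll p 2) (ComplexEll q 2) =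
        (2 : ℝ) ^ max (1 / 2 - (1 / p).toReal) ((1 / q).toReal - 1 / 2)) ∧
    (∀ A : Matrix (Fin 2) (Fin 2) ℂ, 2 * √‖A.det‖ ≤ matrixOpNorm ∞ 1 A) := by
  exact ⟨fun n hn a ha => exists_isUnimodular_norm_stdInner_le hn a ha,
    fun n hn => exists_sqrt_le_norm_stdInner hn,
    fun n hn => le_antisymm (banachMazurDist_one_top_le hn) (sqrt_le_banachMazurDist_one_top hn),
    fun p q _ _ hq hp => le_antisymm (banachMazurDist_le_rpow_max hq hp)
      (rpow_max_le_banachMazurDist hq hp),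
    two_mul_sqrt_norm_det_le_matrixOpNorm⟩
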